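/- All graphs are finite and simple. Write $\chi(G)$ for the chromatic number of $G$. The chromatic edge-stability number $\mathrm{es}_\chi(G)$ is the minimum number of edges of $G$ whose removal results in a graph $G_1$ with $\chi(G_1)=\chi(G)-1$. A graph $G$ is $(3,2)$-critical if $\chi(G)=3$, $\mathrm{es}_\chi(G)=2$, and $\mathrm{es}_\chi(G-e)<\mathrm{es}_\chi(G)$ for every edge $e$ of $G$. The length of a path or cycle is its number of edges, and a path or cycle is odd if its length is odd. Define four families of graphs: - $\mathcal A$: the graphs that are the union of two vertex-disjoint odd cycles. - $\mathcal B$: the graphs that are the union of two odd cycles having exactly one vertex in common. - $\mathcal C$: the graphs that are the union of four paths $Q_1,\dots,Q_4$ between two distinct vertices $x,y$, pairwise having only $x$ and $y$ in common, such that exactly two of the $Q_i$ are odd and at most one of the $Q_i$ has length $1$. - $\mathcal D$: the subdivisions of the complete graph $K_4$ (each of the six edges being replaced by a path of length at least $1$) such that (i) all six paths are odd, and at least one of them has length greater than $1$; or (ii) exactly three of the paths are odd, and these three paths form a cycle; or (iii) exactly two of the paths are odd, and these two paths are vertex-disjoint. **Theorem.** A graph $G$ belongs to $\mathcal A\cup\mathcal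 B\cup\mathcal C\cup\mathcal D$ if and only if $G$ has no isolated vertices, is $(3,2)$-critical, and contains at most four odd cycles. -/

import Mathlib

open SimpleGraph

/-- The chromatic edge-stability number of `G`: the minimum number of edges of `G` whose removal
results in a graph `G₁` with `χ(G₁) = χ(G) - 1` (and `∞` if there is no such set of edges, which
for finite graphs happens only when `G` has no edges). -/
noncomputable def edgeStability {V : Type*} (G : SimpleGraph V) : ℕ∞ :=
  ⨅ (s : Set (Sym2 V)) (_ : s ⊆ G.edgeSet ∧
    (G.deleteEdges s).chromaticNumber + 1 = G.chromaticNumber), s.encard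

/-- `G` is edge-stability critical: deleting any edge lowers the chromatic edge-stability number. -/
def IsEdgeStabilityCritical {V : Type*} (G : SimpleGraph V) : Prop :=
  ∀ e ∈ G.edgeSet, edgeStability (G.deleteEdges {e}) < edgeStability G

/-- `G` is `(k, l)`-critical. -/
def IsKLCritical {V : Type*} (k l : ℕ) (G : SimpleGraph V) : Prop :=
  IsEdgeStabilityCritical G ∧ G.chromaticNumber = (k : ℕ∞) ∧ edgeStability G = (l : ℕ∞)

/-- The odd cycles of `G`, as subgraphs of `G`. -/
def oddCycles {V : Type*} (G : SimpleGraph V) : Set G.Subgraph :=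
  {H | ∃ (v : V) (p : G.Walk v v), p.IsCycle ∧ Odd p.length ∧ H = p.toSubgraph}

/-- Family `𝒜`: `G` is the union of two vertex-disjoint odd cycles. -/
def FamilyA {V : Type*} (G : SimpleGraph V) : Prop :=
  ∃ C D : G.Subgraph, C ∈ oddCycles G ∧ D ∈ oddCycles G ∧ C ⊔ D = ⊤ ∧ C.verts ∩ D.verts = ∅

/-- Family `ℬ`: `G` is the union of two odd cycles that share exactly one vertex. -/
def FamilyB {V : Type*} (G : SimpleGraph V) : Prop :=
  ∃ C D : G.Subgraph, C ∈ oddCycles G ∧ D ∈ oddCycles G ∧ C ⊔ D = ⊤ ∧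
    ∃ v, C.verts ∩ D.verts = {v}

/-- Family `𝒞`: `G` is the union of four internally disjoint paths between two vertices `x ≠ y`,
exactly two of the paths having odd length and at most one of them having length `1`. -/
def FamilyC {V : Type*} (G : SimpleGraph V) : Prop :=
  ∃ (x y : V) (Q : Fin 4 → G.Walk x y), x ≠ y ∧
    (∀ i, (Q i).IsPath) ∧
    (∀ i j, i ≠ j → ∀ v, v ∈ (Q i).support → v ∈ (Q j).support → v = x ∨ v = y) ∧
    {i | Odd (Q i).length}.ncard = 2 ∧
    {i | (Q i).length = 1}.ncard ≤ 1 ∧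
    ⨆ i, (Q i).toSubgraph = ⊤

/-- A presentation of `G` as a subdivision of `H`: the vertices of `H` are sent injectively to
branch vertices of `G`, the edges of `H` are replaced by paths of `G` between the corresponding
branch vertices, paths belonging to different edges of `H` meet only in common ends, no path has a
branch vertex in its interior, and every vertex and edge of `G` arises in this way. -/
structure SubdivisionOf {W V : Type*} (H : SimpleGraph W) (G : SimpleGraph V) where
  /-- the branch vertices -/
  branch : W → V
  branch_injective : Function.Injective branch
  /-- the subdivided paths (one for each edge of `H`, traversed in either direction) -/
  path : ∀ i j : W, H.Adj i j → G.Walk (branch i) (branch j)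
  path_symm : ∀ (i j : W) (h : H.Adj i j), path j i h.symm = (path i j h).reverse
  isPath : ∀ (i j : W) (h : H.Adj i j), (path i j h).IsPath
  branch_mem : ∀ (i j : W) (h : H.Adj i j) (k : W),
    branch k ∈ (path i j h).support → k = i ∨ k = j
  disjoint : ∀ (i j : W) (h : H.Adj i j) (k l : W) (h' : H.Adj k l), s(i, j) ≠ s(k, l) →
    ∀ v, v ∈ (path i j h).support → v ∈ (path k l h').support → ∃ m, v = branch m
  cover_verts : ∀ v : V, (∃ i, v = branch i) ∨
    ∃ (i j : W) (h : H.Adj i j), v ∈ (path i j h).support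
  cover_edges : ∀ e ∈ G.edgeSet, ∃ (i j : W) (h : H.Adj i j), e ∈ (path i j h).edges

/-- Family `𝒟`: `G` is a subdivision of `K₄` in which
(i) all six subdivided paths are odd and not all of them have length `1` (so `G` is not `K₄` itself,
whose chromatic number is `4`), or
(ii) exactly three of them are odd, and these correspond to the edges of a triangle of `K₄`
(that is, their union is a cycle, necessarily odd), or
(iii) exactly two of them are odd, and these correspond to disjoint edges of `K₄`. -/
def FamilyD {V : Type*} (G : SimpleGraph V) : Prop :=
  ∃ S : SubdivisionOf (completeGraph (Fin 4)) G,
    ((∀ a b h, Odd (S.path a b h).length) ∧ ∃ a b h, (S.path a b h).length ≠ 1) ∨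
    (∃ i j k : Fin 4, i ≠ j ∧ j ≠ k ∧ i ≠ k ∧ ∀ a b h, Odd (S.path a b h).length ↔
      s(a, b) = s(i, j) ∨ s(a, b) = s(j, k) ∨ s(a, b) = s(i, k)) ∨
    (∃ i j k l : Fin 4, [i, j, k, l].Nodup ∧ ∀ a b h, Odd (S.path a b h).length ↔
      s(a, b) = s(i, j) ∨ s(a, b) = s(k, l))

/-! Deleting edges makes a graph bipartite exactly when the deleted set meets every odd cycle. So
(3,2)-criticality speaks only about the edge sets of odd cycles: no edge is on all of them, and for
every edge `e` some edge `f` is on all those that avoid `e` (`isKLCritical_three_two_iff`, where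
3-colorability is a separate condition). The main tool is linear algebra over `ZMod 2`: a chain with
zero boundary and odd parity contains an odd cycle in its support (`exists_odd_cycle_of_chain`), and
such a chain is constant along a path whose inner vertices meet no other edge of its support.

From the families to criticality: the graph splits into a few walks on which boundaryless chains are
constant, so odd cycles become coefficient vectors over `ZMod 2`, and what remains is a finite check
(`SeriesDecomposition.isKLCritical_of_admissible_iff`).

Conversely, suppose first that two odd cycles are edge-disjoint. By criticality they contain all
edges. They share no vertex (family A), one (B) or two (C), since three common vertices already
yield five odd cycles. Suppose next that any two odd cycles share an edge, and list them as four.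
The sum of three contains one of the four, and this forces every edge to lie on exactly two
(`exists_pair_of_sum_contains`). These cycles behave like the four triangles of `K₄`: each three of
them have exactly one common vertex, the branch vertex, and each two intersect in a path joining two
branch vertices. So the graph is a subdivision of `K₄` with all triangles odd, and 3-colorability
excludes `K₄` itself (family D). -/

namespace SimpleGraph

variable {V : Type*} {G : SimpleGraph V}

/-! ### Odd cycles and 2-colorings -/

/-- The edge sets of the odd cycles of `G`. -/
def oddCycleEdgeSets (G : SimpleGraph V) : Set (Set (Sym2 V)) :=
  {S | ∃ (v : V) (p : G.Walk v v), p.IsCycle ∧ Odd p.length ∧ S = p.edgeSet}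

namespace Walk

lemma exists_closed_subwalk_of_not_isPath {u v : V} (p : G.Walk u v) (hp : ¬ p.IsPath) :
    ∃ (w : V) (a : G.Walk u w) (b : G.Walk w w) (c : G.Walk w v),
      0 < b.length ∧ p = a.append (b.append c) := by
  classical
  induction p with
  | nil => simp at hp
  | @cons u u' v h p ih =>
    by_cases hu : u ∈ p.support
    · exact ⟨u, nil, cons h (p.takeUntil u hu), p.dropUntil u hu, by simp, by simp⟩
    · obtain ⟨w, a, b, c, hb, rfl⟩ := ih fun hp' => hp (hp'.cons hu)
      exact ⟨w, cons h a, b, c, hb, by simp⟩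

/-- A closed subwalk can be split off whenever the walk repeats a vertex too early. Of the two
closed walks obtained, one is odd and shorter. -/
lemma exists_odd_cycle {u : V} (w : G.Walk u u) (hw : Odd w.length) :
    ∃ (v : V) (p : G.Walk v v), p.IsCycle ∧ Odd p.length ∧ ∀ e ∈ p.edges, e ∈ w.edges := by
  induction hn : w.length using Nat.strong_induction_on generalizing u w with
  | _ n ih =>
    cases w with
    | nil => simp at hw
    | @cons _ v _ h p =>
      by_cases hp : p.IsPath
      · by_cases he : s(u, v) ∈ p.edges
        · have := hp.length_eq_one_of_mem_edges (Sym2.eq_swap ▸ he)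
          simp [this] at hw
          exact absurd hw (by decide)
        · exact ⟨u, cons h p, (cons_isCycle_iff p h).2 ⟨hp, he⟩, hw, fun e he => he⟩
      · obtain ⟨x, a, b, c, hb, rfl⟩ := p.exists_closed_subwalk_of_not_isPath hp
        by_cases hbo : Odd b.length
        · obtain ⟨y, q, hq, hqo, hqe⟩ := ih b.length (by simp at hn; omega) b hbo rfl
          exact ⟨y, q, hq, hqo, fun e he => by simp [hqe e he]⟩
        · obtain ⟨y, q, hq, hqo, hqe⟩ := ih (cons h (a.append c)).length
            (by simp at hn ⊢; omega) (cons h (a.append c))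
            (by simp only [length_cons, length_append] at hw ⊢; grind) rfl
          refine ⟨y, q, hq, hqo, fun e he => ?_⟩
          have := hqe e he
          simp at this ⊢
          tauto

end Walk

lemma colorable_two_iff_no_odd_cycle :
    G.Colorable 2 ↔ ∀ (v : V) (p : G.Walk v v), p.IsCycle → ¬ Odd p.length := by
  rw [two_colorable_iff_forall_loop_even]
  refine ⟨fun h v p _ => by simpa using h v p, fun h u w => ?_⟩
  by_contra hw
  obtain ⟨v, p, hp, hpo, -⟩ := w.exists_odd_cycle (by simpa using hw)
  exact h v p hp hpo

lemma colorable_two_deleteEdges_iff (T : Set (Sym2 V)) :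
    (G.deleteEdges T).Colorable 2 ↔ ∀ S ∈ G.oddCycleEdgeSets, ∃ e ∈ S, e ∈ T := by
  rw [colorable_two_iff_no_odd_cycle]
  constructor
  · rintro h _ ⟨v, p, hp, hpo, rfl⟩
    by_contra! hT
    have hmem : ∀ e ∈ p.edges, e ∈ (G.deleteEdges T).edgeSet := fun e he => by
      rw [edgeSet_deleteEdges]
      exact ⟨p.edges_subset_edgeSet he, hT e he⟩
    exact h v (p.transfer _ hmem) (hp.transfer hmem) (by simpa using hpo)
  · intro h v p hp hpo
    obtain ⟨e, he, heT⟩ := h _ ⟨v, p.mapLe (deleteEdges_le T), hp.mapLe _, by simpa using hpo, rfl⟩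
    have he' : e ∈ p.edges := by simpa using he
    have := p.edges_subset_edgeSet he'
    rw [edgeSet_deleteEdges] at this
    exact this.2 heT

/-! ### Edge chains modulo 2 -/

section Chain

set_option linter.unusedSectionVars false

variable [Fintype V] [DecidableEq V]

/-- The boundary of an edge chain modulo `2`. -/
def chainBoundary : (Sym2 V → ZMod 2) →ₗ[ZMod 2] (V → ZMod 2) where
  toFun x v := ∑ e, if v ∈ e then x e else 0
  map_add' x y := by
    ext v
    simp only [Pi.add_apply, ← Finset.sum_add_distrib]
    exact Finset.sum_congr rfl fun e _ => by split_ifs <;> simp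
  map_smul' c x := by
    ext v
    simp [Finset.mul_sum]

/-- The number of edges of an edge chain modulo `2`. -/
def chainParity : (Sym2 V → ZMod 2) →ₗ[ZMod 2] ZMod 2 where
  toFun x := ∑ e, x e
  map_add' x y := by simp [Finset.sum_add_distrib]
  map_smul' c x := by simp [Finset.mul_sum]

lemma chainParity_apply (x : Sym2 V → ZMod 2) : chainParity x = ∑ e, x e := rfl

lemma chainBoundary_apply (x : Sym2 V → ZMod 2) (v : V) :
    chainBoundary x v = ∑ e, if v ∈ e then x e else 0 := rfl

lemma chainBoundary_single {a b : V} (h : a ≠ b) :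
    chainBoundary (Pi.single s(a, b) 1) = Pi.single a 1 + Pi.single b 1 := by
  ext v
  rw [chainBoundary_apply, Finset.sum_eq_single s(a, b)]
  · by_cases hva : v = a
    · subst hva; simp [h]
    · by_cases hvb : v = b
      · subst hvb; simp [hva]
      · simp [hva, hvb]
  · intro e _ he
    simp [he]
  · simp

/-- Double counting of incidences: boundary and coboundary are adjoint. It is applied with `c`
constant and with `c` a 2-coloring. -/
lemma sum_mul_chainBoundary (c : V → ZMod 2) (x : Sym2 V → ZMod 2) :
    ∑ v, c v * chainBoundary x v = ∑ e, x e * ∑ v, if v ∈ e then c v else 0 := by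
  simp only [chainBoundary_apply, Finset.mul_sum]
  rw [Finset.sum_comm]
  refine Finset.sum_congr rfl fun e _ => Finset.sum_congr rfl fun v _ => ?_
  split_ifs <;> ring

lemma sum_ite_mem_sym2 {M : Type*} [AddCommMonoid M] (c : V → M) {a b : V} (h : a ≠ b) :
    (∑ v, if v ∈ s(a, b) then c v else 0) = c a + c b := by
  rw [← Finset.sum_filter, ← Finset.sum_pair h]
  congr 1
  ext v
  simp

lemma sum_chainBoundary (x : Sym2 V → ZMod 2) (hx : ∀ e, x e ≠ 0 → e ∈ G.edgeSet) :
    ∑ v, chainBoundary x v = 0 := by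
  have := sum_mul_chainBoundary (fun _ => 1) x
  simp only [one_mul] at this
  rw [this]
  refine Finset.sum_eq_zero fun e _ => ?_
  by_cases he : x e = 0
  · simp [he]
  · have hG := hx e he
    induction e with
    | _ a b =>
      rw [sum_ite_mem_sym2 _ (G.ne_of_adj hG), CharTwo.add_self_eq_zero, mul_zero]

/-- Otherwise the support of `x` is bipartite. A 2-coloring takes the value sum 1 on the ends of
every edge of the support, so pairing it with the zero boundary computes the parity of `x` as 0. -/
lemma exists_odd_cycle_of_chain (x : Sym2 V → ZMod 2) (hx : ∀ e, x e ≠ 0 → e ∈ G.edgeSet)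
    (hb : chainBoundary x = 0) (hp : chainParity x = 1) :
    ∃ S ∈ G.oddCycleEdgeSets, ∀ e ∈ S, x e ≠ 0 := by
  by_contra! hS
  have hc : (G.deleteEdges {e | x e = 0}).Colorable 2 :=
    (colorable_two_deleteEdges_iff _).2 fun S hSm => hS S hSm
  obtain ⟨c⟩ := hc
  have key := sum_mul_chainBoundary (fun v => ((c v : ℕ) : ZMod 2)) x
  rw [hb] at key
  simp only [Pi.zero_apply, mul_zero, Finset.sum_const_zero] at key
  have : chainParity x = 0 := by
    rw [chainParity_apply, key]
    refine Finset.sum_congr rfl fun e _ => ?_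
    by_cases he : x e = 0
    · simp [he]
    · have hG := hx e he
      induction e with
      | _ a b =>
        rw [sum_ite_mem_sym2 _ (G.ne_of_adj hG)]
        have hne : c a ≠ c b := c.valid (by simpa [deleteEdges_adj] using ⟨hG, he⟩)
        have : ∀ i j : Fin 2, i ≠ j → ((i : ℕ) : ZMod 2) + ((j : ℕ) : ZMod 2) = 1 := by decide
        rw [this _ _ hne, mul_one]
  rw [this] at hp
  exact zero_ne_one hp

end Chain

namespace Walk

/-- The edge chain of a walk, counting edges modulo `2`. -/
def chain [DecidableEq V] {u v : V} (p : G.Walk u v) : Sym2 V → ZMod 2 :=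
  fun e => (p.edges.count e : ZMod 2)

lemma chain_nil [DecidableEq V] (u : V) : (nil : G.Walk u u).chain = 0 := by
  ext e
  simp [chain]

lemma chain_cons [DecidableEq V] {u v w : V} (h : G.Adj u v) (p : G.Walk v w) :
    (cons h p).chain = Pi.single s(u, v) 1 + p.chain := by
  ext e
  by_cases he : e = s(u, v)
  · subst he; simp [chain, add_comm]
  · simp [chain, he, Ne.symm he]

lemma chainBoundary_chain [Fintype V] [DecidableEq V] {u v : V} (p : G.Walk u v) :
    chainBoundary p.chain = Pi.single u 1 + Pi.single v 1 := by
  induction p with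
  | nil =>
    rw [chain_nil, map_zero]
    ext w
    simp [CharTwo.add_self_eq_zero]
  | @cons u v w h p ih =>
    rw [chain_cons, map_add, chainBoundary_single h.ne, ih]
    ext y
    simp only [Pi.add_apply]
    have := CharTwo.add_self_eq_zero ((Pi.single v (1 : ZMod 2) : V → ZMod 2) y)
    linear_combination this

lemma chainParity_chain [Fintype V] [DecidableEq V] {u v : V} (p : G.Walk u v) :
    chainParity p.chain = (p.length : ZMod 2) := by
  induction p with
  | nil => rw [chain_nil]; simp
  | @cons u v w h p ih =>
    rw [chain_cons, map_add, ih]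
    simp [chainParity_apply, add_comm]

lemma IsTrail.chain_apply [DecidableEq V] {u v : V} {p : G.Walk u v} (hp : p.IsTrail)
    (e : Sym2 V) : p.chain e = if e ∈ p.edges then 1 else 0 := by
  split_ifs with h
  · simp [chain, List.count_eq_one_of_mem hp.edges_nodup h]
  · simp [chain, List.count_eq_zero_of_not_mem h]

end Walk

/-! ### Chains along paths and cycles -/

lemma chainBoundary_eq_add [Fintype V] [DecidableEq V] {x : Sym2 V → ZMod 2} {v : V}
    {e f : Sym2 V} (hef : e ≠ f) (he : v ∈ e) (hf : v ∈ f)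
    (h : ∀ g, v ∈ g → x g ≠ 0 → g = e ∨ g = f) : chainBoundary x v = x e + x f := by
  rw [chainBoundary_apply, Finset.sum_eq_add e f hef]
  · simp [he, hf]
  · rintro g - ⟨hge, hgf⟩
    by_contra hg
    rw [ite_eq_right_iff] at hg
    push Not at hg
    rcases h g hg.1 hg.2 with h | h
    · exact hge h
    · exact hgf h
  · simp
  · simp

namespace Walk

lemma exists_mem_edges_start {u v : V} (p : G.Walk u v) (h : u ≠ v) :
    ∃ w, s(u, w) ∈ p.edges := by
  cases p with
  | nil => exact absurd rfl h
  | cons h p => exact ⟨_, by rw [edges_cons]; exact List.mem_cons_self⟩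

/-- At `v` only the edge `s(u, v)` and the first edge of `p` can carry `x`, so the vanishing
boundary there makes their values equal. This is the propagation step for both paths and cycles. -/
lemma chain_eq_of_cons [Fintype V] [DecidableEq V] {u v w : V} (h : G.Adj u v) {p : G.Walk v w}
    (hp : p.IsPath) (hvw : v ≠ w) (hs : s(u, v) ∉ p.edges) {x : Sym2 V → ZMod 2} {c : ZMod 2}
    (hb : chainBoundary x v = 0) (hx : ∀ e, v ∈ e → x e ≠ 0 → e ∈ (cons h p).edges)
    (hc : ∀ e ∈ p.edges, x e = c) : x s(u, v) = c := by
  cases p with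
  | nil => exact absurd rfl hvw
  | @cons _ y _ h' p =>
    rw [cons_isPath_iff] at hp
    rw [chainBoundary_eq_add (e := s(u, v)) (f := s(v, y))
      (by rintro heq; exact hs (by simp [heq])) (by simp) (by simp), hc s(v, y) (by simp)] at hb
    · exact CharTwo.add_eq_zero.1 hb
    · intro g hvg hg
      have := hx g hvg hg
      simp only [edges_cons, List.mem_cons] at this
      rcases this with h1 | h1 | h1
      · exact .inl h1
      · exact .inr h1
      · exact absurd (p.mem_support_of_mem_edges h1 hvg) hp.2

lemma IsPath.exists_chain_eq [Fintype V] [DecidableEq V] {u v : V} {p : G.Walk u v}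
    (hp : p.IsPath) {x : Sym2 V → ZMod 2}
    (hb : ∀ w ∈ p.support, w ≠ u → w ≠ v → chainBoundary x w = 0)
    (hx : ∀ w ∈ p.support, w ≠ u → w ≠ v → ∀ e, w ∈ e → x e ≠ 0 → e ∈ p.edges) :
    ∃ c, ∀ e ∈ p.edges, x e = c := by
  induction p with
  | nil => simp
  | @cons u v w h p ih =>
    have hpp := hp
    rw [cons_isPath_iff] at hp
    have hus : ∀ y ∈ p.support, y ≠ u := fun y hy hyu => hp.2 (hyu ▸ hy)
    obtain ⟨c, hc⟩ := ih hp.1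
      (fun y hy hyv hyw => hb y (by simp [hy]) (hus y hy) hyw)
      (fun y hy hyv hyw e hye he => by
        have := hx y (by simp [hy]) (hus y hy) hyw e hye he
        simp only [edges_cons, List.mem_cons] at this
        rcases this with rfl | h1
        · simp [hyv, hus y hy] at hye
        · exact h1)
    by_cases hvw : v = w
    · subst hvw
      have : p = Walk.nil := by simpa using hp.1
      subst this
      exact ⟨x s(u, v), by simp⟩
    · refine ⟨c, ?_⟩
      have hs : s(u, v) ∉ p.edges := fun hs => hp.2 (p.fst_mem_support_of_mem_edges hs)
      have := chain_eq_of_cons h hp.1 hvw hs (hb v (by simp) h.ne' hvw)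
        (hx v (by simp) h.ne' hvw) hc
      simpa [this] using hc

/-- The base point is exempt from both hypotheses, so that the lemma still applies to two cycles
glued at it. -/
lemma IsCycle.exists_chain_eq [Fintype V] [DecidableEq V] {u : V} {p : G.Walk u u}
    (hp : p.IsCycle) {x : Sym2 V → ZMod 2}
    (hb : ∀ w ∈ p.support, w ≠ u → chainBoundary x w = 0)
    (hx : ∀ w ∈ p.support, w ≠ u → ∀ e, w ∈ e → x e ≠ 0 → e ∈ p.edges) :
    ∃ c, ∀ e ∈ p.edges, x e = c := by
  cases p with
  | nil => simp
  | @cons _ v _ h p =>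
    rw [cons_isCycle_iff] at hp
    obtain ⟨c, hc⟩ := hp.1.exists_chain_eq (x := x)
      (fun y hy hyv hyw => hb y (by simp [hy]) hyw)
      (fun y hy hyv hyw e hye he => by
        have := hx y (by simp [hy]) hyw e hye he
        simp only [edges_cons, List.mem_cons] at this
        rcases this with rfl | h1
        · simp [hyv, hyw] at hye
        · exact h1)
    refine ⟨c, ?_⟩
    have := chain_eq_of_cons h hp.1 h.ne' hp.2 (hb v (by simp) h.ne') (hx v (by simp) h.ne') hc
    simpa [this] using hc

/-- A chain without boundary that is supported on a cycle is constant on it. -/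
lemma IsCycle.exists_chain_eq_of_boundary_eq_zero [Fintype V] [DecidableEq V] {u : V}
    {p : G.Walk u u} (hp : p.IsCycle) {x : Sym2 V → ZMod 2} (hb : chainBoundary x = 0)
    (hx : ∀ e, x e ≠ 0 → e ∈ p.edges) : ∃ c, ∀ e ∈ p.edges, x e = c :=
  hp.exists_chain_eq (fun w _ _ => by rw [hb]; rfl) fun _ _ _ e _ he => hx e he

/-- The two arcs into which two vertices cut a cycle. -/
lemma IsCycle.exists_arcs {w u v : V} {c : G.Walk w w} (hc : c.IsCycle) (hu : u ∈ c.support)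
    (hv : v ∈ c.support) (huv : u ≠ v) :
    ∃ (p q : G.Walk u v), p.IsPath ∧ q.IsPath ∧ p.length + q.length = c.length ∧
      (∀ e, e ∈ c.edges ↔ e ∈ p.edges ∨ e ∈ q.edges) ∧
      (∀ e, e ∈ p.edges → e ∉ q.edges) ∧
      (∀ y, y ∈ c.support ↔ y ∈ p.support ∨ y ∈ q.support) ∧
      (∀ y, y ∈ p.support → y ∈ q.support → y = u ∨ y = v) := by
  classical
  have hc' : (c.rotate u hu).IsCycle := hc.rotate hu
  have hv' : v ∈ (c.rotate u hu).support := by simpa using hv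
  obtain ⟨p, q, hpq⟩ := mem_support_iff_exists_append.1 hv'
  have hpn : ¬ p.Nil := not_nil_of_ne huv
  have hqn : ¬ q.Nil := not_nil_of_ne huv.symm
  have hedges := (c.rotate_edges u hu).perm
  rw [hpq] at hc' hedges
  have hlen : c.length = (c.rotate u hu).length := by simp
  refine ⟨p, q.reverse, hc'.isPath_of_append_left hqn,
    (hc'.isPath_of_append_right hpn).reverse, ?_, ?_, ?_, ?_, ?_⟩
  · rw [hlen, hpq]; simp
  · intro e
    rw [← hedges.mem_iff]
    simp
  · intro e he hq
    have := hc'.edges_nodup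
    rw [edges_append] at this
    exact List.disjoint_of_nodup_append this he (by simpa using hq)
  · intro y
    rw [← mem_support_rotate_iff c u hu, hpq]
    simp [mem_support_append_iff]
  · intro y hyp hyq
    have hn := hc'.support_nodup
    rw [tail_support_append] at hn
    have hd := List.disjoint_of_nodup_append hn
    rw [support_reverse, List.mem_reverse] at hyq
    by_contra! hy
    refine hd ?_ ?_ (a := y)
    · exact (p.mem_support_iff.1 hyp).resolve_left hy.1
    · exact (q.mem_support_iff.1 hyq).resolve_left hy.2

end Walk

/-! ### Criticality in terms of odd cycles -/

lemma encard_oddCycles : (oddCycles G).encard = G.oddCycleEdgeSets.encard := by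
  have himg : G.oddCycleEdgeSets = Subgraph.edgeSet '' oddCycles G := by
    ext S
    constructor
    · rintro ⟨v, p, hp, hpo, rfl⟩
      exact ⟨p.toSubgraph, ⟨v, p, hp, hpo, rfl⟩, p.edgeSet_toSubgraph⟩
    · rintro ⟨_, ⟨v, p, hp, hpo, rfl⟩, rfl⟩
      exact ⟨v, p, hp, hpo, p.edgeSet_toSubgraph⟩
  rw [himg, Set.InjOn.encard_image]
  rintro _ ⟨v, p, hp, hpo, rfl⟩ _ ⟨w, q, hq, hqo, rfl⟩ h
  apply le_antisymm
  · rw [Walk.toSubgraph_le_iff hp.not_nil, ← h, Walk.edgeSet_toSubgraph]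
  · rw [Walk.toSubgraph_le_iff hq.not_nil, h, Walk.edgeSet_toSubgraph]

lemma subset_edgeSet_of_mem_oddCycleEdgeSets {S : Set (Sym2 V)} (hS : S ∈ G.oddCycleEdgeSets) :
    S ⊆ G.edgeSet := by
  obtain ⟨v, p, -, -, rfl⟩ := hS
  exact fun e he => p.edges_subset_edgeSet he

/-- A cycle has at least three edges. Hence deleting one or two edges leaves an edge, and a
bipartite remainder has chromatic number exactly 2. -/
lemma exists_mem_ne_of_mem_oddCycleEdgeSets {S : Set (Sym2 V)} (hS : S ∈ G.oddCycleEdgeSets)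
    (e f : Sym2 V) : ∃ g ∈ S, g ≠ e ∧ g ≠ f := by
  classical
  obtain ⟨v, p, hp, -, rfl⟩ := hS
  by_contra! h
  have hsub : p.edges.toFinset ⊆ {e, f} := fun g hg => by
    have := h g (by simpa using hg)
    simp only [Finset.mem_insert, Finset.mem_singleton]
    tauto
  have h1 := Finset.card_le_card hsub
  rw [List.toFinset_card_of_nodup hp.edges_nodup, Walk.length_edges] at h1
  have h2 := hp.three_le_length
  have h3 := Finset.card_le_two (a := e) (b := f)
  omega

lemma nonempty_of_mem_oddCycleEdgeSets {S : Set (Sym2 V)} (hS : S ∈ G.oddCycleEdgeSets) :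
    S.Nonempty := by
  obtain ⟨v, p, hp, -, rfl⟩ := id hS
  obtain ⟨g, hg, -⟩ := exists_mem_ne_of_mem_oddCycleEdgeSets hS s(v, v) s(v, v)
  exact ⟨g, hg⟩

lemma chromaticNumber_eq_three_iff :
    G.chromaticNumber = 3 ↔ G.Colorable 3 ∧ G.oddCycleEdgeSets.Nonempty := by
  have h2 : G.oddCycleEdgeSets.Nonempty ↔ ¬ G.Colorable 2 := by
    have := colorable_two_deleteEdges_iff (G := G) ∅
    rw [deleteEdges_empty] at this
    simp [this, Set.Nonempty]
  rw [h2, ← chromaticNumber_le_iff_colorable, ← chromaticNumber_le_iff_colorable, not_le]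
  constructor
  · intro h
    rw [h]
    exact ⟨by norm_num, by norm_num⟩
  · rintro ⟨h3, h4⟩
    refine le_antisymm h3 ?_
    have := Order.add_one_le_of_lt h4
    norm_num at this
    exact this

lemma chromaticNumber_deleteEdges_eq_two {T : Set (Sym2 V)} (hT : (G.deleteEdges T).Colorable 2)
    {e : Sym2 V} (he : e ∈ G.edgeSet) (heT : e ∉ T) :
    (G.deleteEdges T).chromaticNumber = 2 := by
  rw [chromaticNumber_eq_two_iff]
  refine ⟨hT, fun h => heT ?_⟩
  rw [deleteEdges_eq_bot] at h
  exact h he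

lemma _root_.ENat.lt_two_iff_le_one {x : ℕ∞} : x < 2 ↔ x ≤ 1 := by
  rw [← ENat.lt_add_one_iff (by norm_num)]
  norm_num

/-- A deleted set that lowers the chromatic number to 2 meets every odd cycle; with at most one
element, it must meet them all in the same edge. -/
lemma edgeStability_le_one_iff (h3 : G.chromaticNumber = 3) :
    edgeStability G ≤ 1 ↔ ∃ f, ∀ S ∈ G.oddCycleEdgeSets, f ∈ S := by
  obtain ⟨-, S₀, hS₀⟩ := chromaticNumber_eq_three_iff.1 h3
  constructor
  · intro h
    have : edgeStability G < 2 := lt_of_le_of_lt h (by norm_num)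
    simp only [edgeStability, iInf_lt_iff] at this
    obtain ⟨s, ⟨hs, hc⟩, hs2⟩ := this
    rw [h3] at hc
    have hc2 : (G.deleteEdges s).Colorable 2 := by
      rw [← chromaticNumber_le_iff_colorable]
      generalize (G.deleteEdges s).chromaticNumber = x at hc
      induction x using ENat.recTopCoe with
      | top => simp at hc
      | coe n =>
        norm_cast at hc ⊢
        omega
    rw [colorable_two_deleteEdges_iff] at hc2
    obtain ⟨f, hf, hfs⟩ := hc2 S₀ hS₀
    refine ⟨f, fun S hS => ?_⟩
    obtain ⟨g, hg, hgs⟩ := hc2 S hS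
    have : s.encard ≤ 1 := ENat.lt_two_iff_le_one.1 hs2
    rw [Set.encard_le_one_iff] at this
    rwa [this f g hfs hgs]
  · rintro ⟨f, hf⟩
    have hT : (G.deleteEdges {f}).Colorable 2 :=
      (colorable_two_deleteEdges_iff _).2 fun S hS => ⟨f, hf S hS, rfl⟩
    obtain ⟨g, hg, hgf, -⟩ := exists_mem_ne_of_mem_oddCycleEdgeSets hS₀ f f
    have h2 := chromaticNumber_deleteEdges_eq_two hT
      (subset_edgeSet_of_mem_oddCycleEdgeSets hS₀ hg) (by simpa using hgf)
    rw [← Set.encard_singleton f]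
    refine iInf₂_le _ ⟨?_, ?_⟩
    · simpa using subset_edgeSet_of_mem_oddCycleEdgeSets hS₀ (hf _ hS₀)
    · rw [h2, h3]; norm_num

lemma mem_oddCycleEdgeSets_deleteEdges {T S : Set (Sym2 V)} :
    S ∈ (G.deleteEdges T).oddCycleEdgeSets ↔ S ∈ G.oddCycleEdgeSets ∧ ∀ e ∈ S, e ∉ T := by
  constructor
  · rintro ⟨v, p, hp, hpo, rfl⟩
    refine ⟨⟨v, p.mapLe (deleteEdges_le T), hp.mapLe _, by simpa using hpo, ?_⟩, fun e he => ?_⟩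
    · ext e; simp
    · have := p.edges_subset_edgeSet he
      rw [edgeSet_deleteEdges] at this
      exact this.2
  · rintro ⟨⟨v, p, hp, hpo, rfl⟩, hT⟩
    have hmem : ∀ e ∈ p.edges, e ∈ (G.deleteEdges T).edgeSet := fun e he => by
      rw [edgeSet_deleteEdges]
      exact ⟨p.edges_subset_edgeSet he, hT e he⟩
    refine ⟨v, p.transfer _ hmem, hp.transfer hmem, by simpa using hpo, ?_⟩
    ext e
    simp

/-- The odd cycles of `G - e` are those of `G` avoiding `e`, so criticality at `e` is
`edgeStability_le_one_iff` for `G - e`. For stability 2 in the reverse direction, `e` and its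
partner `f` together meet every odd cycle. -/
lemma isKLCritical_three_two_iff :
    IsKLCritical 3 2 G ↔ G.Colorable 3 ∧ G.oddCycleEdgeSets.Nonempty ∧
      (∀ f, ∃ S ∈ G.oddCycleEdgeSets, f ∉ S) ∧
      ∀ e ∈ G.edgeSet, ∃ f, ∀ S ∈ G.oddCycleEdgeSets, e ∉ S → f ∈ S := by
  -- Some odd cycle avoids `e`, so the chromatic number stays 3 after its deletion.
  have h3del : (∀ f, ∃ S ∈ G.oddCycleEdgeSets, f ∉ S) → G.Colorable 3 → ∀ e,
      (G.deleteEdges {e}).chromaticNumber = 3 := by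
    intro h hc e
    obtain ⟨S, hS, heS⟩ := h e
    refine chromaticNumber_eq_three_iff.2 ⟨hc.mono_left (deleteEdges_le _), S,
      mem_oddCycleEdgeSets_deleteEdges.2 ⟨hS, fun g hg => ?_⟩⟩
    rintro rfl
    exact heS hg
  constructor
  · rintro ⟨hcrit, h3, h2⟩
    have h3' : G.chromaticNumber = 3 := h3
    have h2' : edgeStability G = 2 := h2
    obtain ⟨hc, hne⟩ := chromaticNumber_eq_three_iff.1 h3'
    have hno : ∀ f, ∃ S ∈ G.oddCycleEdgeSets, f ∉ S := by
      by_contra! hf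
      have := (edgeStability_le_one_iff h3').2 hf
      rw [h2'] at this
      norm_num at this
    refine ⟨hc, hne, hno, fun e he => ?_⟩
    have := hcrit e he
    rw [h2', ENat.lt_two_iff_le_one, edgeStability_le_one_iff (h3del hno hc e)] at this
    obtain ⟨f, hf⟩ := this
    refine ⟨f, fun S hS heS => hf S (mem_oddCycleEdgeSets_deleteEdges.2 ⟨hS, fun g hg => ?_⟩)⟩
    rintro rfl
    exact heS hg
  · rintro ⟨hc, hne, hno, hcov⟩
    have h3 := chromaticNumber_eq_three_iff.2 ⟨hc, hne⟩
    have hge : ¬ edgeStability G ≤ 1 := by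
      rw [edgeStability_le_one_iff h3]
      push Not
      exact hno
    rw [← ENat.lt_two_iff_le_one, not_lt] at hge
    have h2 : edgeStability G = 2 := by
      refine le_antisymm ?_ hge
      obtain ⟨S₀, hS₀⟩ := hne
      obtain ⟨e, he⟩ := nonempty_of_mem_oddCycleEdgeSets hS₀
      obtain ⟨f, hf⟩ := hcov e (subset_edgeSet_of_mem_oddCycleEdgeSets hS₀ he)
      obtain ⟨S₁, hS₁, heS₁⟩ := hno e
      have hfS₁ := hf S₁ hS₁ heS₁
      have hT : (G.deleteEdges {e, f}).Colorable 2 :=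
        (colorable_two_deleteEdges_iff _).2 fun S hS => by
          by_cases heS : e ∈ S
          · exact ⟨e, heS, by simp⟩
          · exact ⟨f, hf S hS heS, by simp⟩
      obtain ⟨g, hg, hge, hgf⟩ := exists_mem_ne_of_mem_oddCycleEdgeSets hS₀ e f
      have h2 := chromaticNumber_deleteEdges_eq_two hT
        (subset_edgeSet_of_mem_oddCycleEdgeSets hS₀ hg) (by simp [hge, hgf])
      refine le_trans (iInf₂_le {e, f} ⟨?_, ?_⟩) ((Set.encard_insert_le _ _).trans (by rw [Set.encard_singleton]; norm_num))
      · rintro _ (rfl | rfl)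
        · exact subset_edgeSet_of_mem_oddCycleEdgeSets hS₀ he
        · exact subset_edgeSet_of_mem_oddCycleEdgeSets hS₁ hfS₁
      · rw [h2, h3]; norm_num
    refine ⟨fun e he => ?_, h3, h2⟩
    rw [h2, ENat.lt_two_iff_le_one, edgeStability_le_one_iff (h3del hno hc e)]
    obtain ⟨f, hf⟩ := hcov e he
    exact ⟨f, fun S hS => hf S (mem_oddCycleEdgeSets_deleteEdges.1 hS).1
      fun heS => (mem_oddCycleEdgeSets_deleteEdges.1 hS).2 e heS rfl⟩

/-- A graph in which some independent set meets every odd cycle is `3`-colorable. -/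
lemma colorable_three_of_isIndepSet {I : Set V} (hI : ∀ v ∈ I, ∀ w ∈ I, ¬ G.Adj v w)
    (h : ∀ S ∈ G.oddCycleEdgeSets, ∃ e ∈ S, ∃ v ∈ I, v ∈ e) : G.Colorable 3 := by
  classical
  obtain ⟨c⟩ := (colorable_two_deleteEdges_iff {e | ∃ v ∈ I, v ∈ e}).2 h
  refine ⟨Coloring.mk (fun v => if v ∈ I then 2 else (c v).castSucc) fun {v w} hvw => ?_⟩
  by_cases hv : v ∈ I
  · by_cases hw : w ∈ I
    · exact absurd hvw (hI v hv w hw)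
    · simp only [hv, hw, if_true, if_false]
      exact (Fin.castSucc_lt_last (c w)).ne'
  · by_cases hw : w ∈ I
    · simp only [hv, hw, if_true, if_false]
      exact (Fin.castSucc_lt_last (c v)).ne
    · simp only [hv, hw, if_false]
      refine fun heq => c.valid (v := v) (w := w) ?_ (Fin.castSucc_injective _ heq)
      rw [deleteEdges_adj]
      refine ⟨hvw, ?_⟩
      rintro ⟨y, hy, hye⟩
      rw [Sym2.mem_iff] at hye
      rcases hye with rfl | rfl
      · exact hv hy
      · exact hw hy

/-! ### Series decompositions -/

/-- A decomposition of the edges of `G` into walks on each of which every chain of `G` without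
boundary is constant. -/
structure SeriesDecomposition [Fintype V] [DecidableEq V] (G : SimpleGraph V) (ι : Type*) where
  /-- the first vertices of the walks -/
  src : ι → V
  /-- the last vertices of the walks -/
  tgt : ι → V
  /-- the walks -/
  walk : ∀ i, G.Walk (src i) (tgt i)
  isTrail : ∀ i, (walk i).IsTrail
  not_nil : ∀ i, ¬ (walk i).Nil
  disjoint : ∀ i j, i ≠ j → ∀ e ∈ (walk i).edges, e ∉ (walk j).edges
  cover : ∀ e ∈ G.edgeSet, ∃ i, e ∈ (walk i).edges
  exists_chain_eq : ∀ (i : ι) (x : Sym2 V → ZMod 2), chainBoundary x = 0 →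
    (∀ e, x e ≠ 0 → e ∈ G.edgeSet) → ∃ c, ∀ e ∈ (walk i).edges, x e = c

namespace SeriesDecomposition

variable [Fintype V] [DecidableEq V] {ι : Type*} [Fintype ι]
  (D : SeriesDecomposition G ι)

/-- The coefficient vectors of the chains of odd parity without boundary. -/
def Admissible (a : ι → ZMod 2) : Prop :=
  (∀ v, ∑ i, a i * ((Pi.single (D.src i) 1 : V → ZMod 2) v +
    (Pi.single (D.tgt i) 1 : V → ZMod 2) v) = 0) ∧
    ∑ i, a i * ((D.walk i).length : ZMod 2) = 1

/-- The chain with coefficients `a`. -/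
def chainOf (a : ι → ZMod 2) : Sym2 V → ZMod 2 := ∑ i, a i • (D.walk i).chain

lemma chainOf_apply (a : ι → ZMod 2) {i : ι} {e : Sym2 V} (he : e ∈ (D.walk i).edges) :
    D.chainOf a e = a i := by
  rw [chainOf, Finset.sum_apply, Finset.sum_eq_single i]
  · simp [(D.isTrail i).chain_apply, he]
  · intro j _ hj
    simp [(D.isTrail j).chain_apply, D.disjoint i j hj.symm e he]
  · simp

lemma chainOf_apply_of_notMem (a : ι → ZMod 2) {e : Sym2 V} (he : e ∉ G.edgeSet) :
    D.chainOf a e = 0 := by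
  rw [chainOf, Finset.sum_apply]
  refine Finset.sum_eq_zero fun j _ => ?_
  have : e ∉ (D.walk j).edges := fun h => he ((D.walk j).edges_subset_edgeSet h)
  simp [(D.isTrail j).chain_apply, this]

lemma chainBoundary_chainOf (a : ι → ZMod 2) (v : V) :
    chainBoundary (D.chainOf a) v = ∑ i, a i * ((Pi.single (D.src i) 1 : V → ZMod 2) v +
      (Pi.single (D.tgt i) 1 : V → ZMod 2) v) := by
  simp [chainOf, map_sum, Walk.chainBoundary_chain, mul_add]

lemma chainParity_chainOf (a : ι → ZMod 2) :
    chainParity (D.chainOf a) = ∑ i, a i * ((D.walk i).length : ZMod 2) := by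
  simp [chainOf, map_sum, Walk.chainParity_chain]

lemma exists_eq_chainOf (x : Sym2 V → ZMod 2) (hb : chainBoundary x = 0)
    (hx : ∀ e, x e ≠ 0 → e ∈ G.edgeSet) : ∃ a, x = D.chainOf a := by
  choose a ha using fun i => D.exists_chain_eq i x hb hx
  refine ⟨a, funext fun e => ?_⟩
  by_cases he : e ∈ G.edgeSet
  · obtain ⟨i, hi⟩ := D.cover e he
    rw [D.chainOf_apply a hi, ha i e hi]
  · rw [D.chainOf_apply_of_notMem a he]
    by_contra h
    exact he (hx e h)

/-- The chain of a cycle has no boundary, so it is constant on each walk: the cycle uses each walk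
entirely or not at all. -/
lemma exists_admissible {S : Set (Sym2 V)} (hS : S ∈ G.oddCycleEdgeSets) :
    ∃ a, D.Admissible a ∧ ∀ i, ∀ e ∈ (D.walk i).edges, e ∈ S ↔ a i = 1 := by
  obtain ⟨v, p, hp, hpo, rfl⟩ := hS
  have hb : chainBoundary p.chain = 0 := by
    rw [Walk.chainBoundary_chain]
    ext w
    simp [CharTwo.add_self_eq_zero]
  obtain ⟨a, ha⟩ := D.exists_eq_chainOf p.chain hb fun e he => by
    by_contra hG
    have : e ∉ p.edges := fun h => hG (p.edges_subset_edgeSet h)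
    simp [hp.isTrail.chain_apply, this] at he
  refine ⟨a, ⟨fun v => ?_, ?_⟩, fun i e he => ?_⟩
  · rw [← chainBoundary_chainOf, ← ha, hb]; rfl
  · rw [← chainParity_chainOf, ← ha, Walk.chainParity_chain]
    exact (ZMod.natCast_eq_one_iff_odd).2 hpo
  · rw [← D.chainOf_apply a he, ← ha, hp.isTrail.chain_apply]
    simp

lemma exists_odd_cycle_of_admissible {a : ι → ZMod 2} (ha : D.Admissible a) :
    ∃ S ∈ G.oddCycleEdgeSets, ∀ i, ∀ e ∈ (D.walk i).edges, e ∈ S → a i = 1 := by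
  obtain ⟨S, hS, h⟩ := exists_odd_cycle_of_chain (G := G) (D.chainOf a)
    (fun e he => by
      by_contra hG
      exact he (D.chainOf_apply_of_notMem a hG))
    (funext fun v => by rw [D.chainBoundary_chainOf]; exact ha.1 v)
    (by rw [D.chainParity_chainOf]; exact ha.2)
  refine ⟨S, hS, fun i e he heS => ?_⟩
  have := h e heS
  rw [D.chainOf_apply a he] at this
  exact (Fin.eq_one_of_ne_zero _ this :)

/-- If the odd chains without boundary are those with coefficient vectors `T k`, the properties of
the odd cycles of `G` can be read off from the vectors `T k`. -/
theorem isKLCritical_of_admissible_iff {m : ℕ} (T : Fin m → ι → ZMod 2) (hm0 : 0 < m) (hm : m ≤ 4)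
    (hT : ∀ a, D.Admissible a ↔ ∃ k, a = T k) (h1 : ∀ i, ∃ k, T k i = 0)
    (h2 : ∀ i, ∃ j, ∀ k, T k i = 0 → T k j = 1) {I : Set V}
    (hI : ∀ v ∈ I, ∀ w ∈ I, ¬ G.Adj v w)
    (hTI : ∀ k, ∃ i, T k i = 1 ∧ ∃ v ∈ I, v ∈ (D.walk i).support) :
    IsKLCritical 3 2 G ∧ (oddCycles G).encard ≤ 4 := by
  have hsub : ∀ S ∈ G.oddCycleEdgeSets, ∃ k, ∀ i, ∀ e ∈ (D.walk i).edges, e ∈ S ↔ T k i = 1 := by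
    intro S hS
    obtain ⟨a, ha, haS⟩ := D.exists_admissible hS
    obtain ⟨k, rfl⟩ := (hT a).1 ha
    exact ⟨k, haS⟩
  have hex : ∀ k, ∃ S ∈ G.oddCycleEdgeSets, ∀ i, ∀ e ∈ (D.walk i).edges, e ∈ S → T k i = 1 :=
    fun k => D.exists_odd_cycle_of_admissible ((hT _).2 ⟨k, rfl⟩)
  obtain ⟨S₀, hS₀, -⟩ := hex ⟨0, hm0⟩
  have hedge : ∀ i, ∃ e, e ∈ (D.walk i).edges := fun i => by
    by_contra! h
    exact D.not_nil i (Walk.edges_eq_nil.1 (List.eq_nil_iff_forall_not_mem.2 h))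
  refine ⟨isKLCritical_three_two_iff.2 ⟨?_, ⟨S₀, hS₀⟩, fun f => ?_, fun e he => ?_⟩, ?_⟩
  · refine colorable_three_of_isIndepSet hI fun S hS => ?_
    obtain ⟨k, hk⟩ := hsub S hS
    obtain ⟨i, hi, v, hv, hvi⟩ := hTI k
    obtain ⟨e, he, hve⟩ := (Walk.mem_support_iff_exists_mem_edges_of_not_nil (D.not_nil i)).1 hvi
    exact ⟨e, (hk i e he).2 hi, v, hv, hve⟩
  · by_cases hf : f ∈ G.edgeSet
    · obtain ⟨i, hi⟩ := D.cover f hf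
      obtain ⟨k, hk⟩ := h1 i
      obtain ⟨S, hS, hSk⟩ := hex k
      refine ⟨S, hS, fun hfS => ?_⟩
      have := hSk i f hi hfS
      rw [hk] at this
      exact zero_ne_one this
    · exact ⟨S₀, hS₀, fun h => hf (subset_edgeSet_of_mem_oddCycleEdgeSets hS₀ h)⟩
  -- An odd cycle avoiding `e` avoids the whole walk `i`, hence uses all of the walk `j` from `h2`;
  -- any edge of the latter serves as `f`.
  · obtain ⟨i, hi⟩ := D.cover e he
    obtain ⟨j, hj⟩ := h2 i
    obtain ⟨f, hf⟩ := hedge j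
    refine ⟨f, fun S hS heS => ?_⟩
    obtain ⟨k, hk⟩ := hsub S hS
    refine (hk j f hf).2 (hj k ?_)
    by_contra h
    exact heS ((hk i e hi).2 (Fin.eq_one_of_ne_zero _ h :))
  · rw [encard_oddCycles]
    have hsubset : G.oddCycleEdgeSets ⊆
        Set.range fun k : Fin m => {e | ∃ i, e ∈ (D.walk i).edges ∧ T k i = 1} := by
      intro S hS
      obtain ⟨k, hk⟩ := hsub S hS
      refine ⟨k, Set.ext fun e => ⟨?_, fun heS => ?_⟩⟩
      · rintro ⟨i, hi, hki⟩
        exact (hk i e hi).2 hki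
      · obtain ⟨i, hi⟩ := D.cover e (subset_edgeSet_of_mem_oddCycleEdgeSets hS heS)
        exact ⟨i, hi, (hk i e hi).1 heS⟩
    refine (Set.encard_le_encard hsubset).trans ?_
    rw [← Set.image_univ]
    refine (Set.encard_image_le _ _).trans ?_
    rw [Set.encard_univ, ENat.card_eq_coe_fintype_card, Fintype.card_fin]
    exact_mod_cast hm

end SeriesDecomposition

/-! ### Families A and B are critical -/

/-- Two cycles whose supports meet at most in their common base point give a decomposition. -/
def SeriesDecomposition.ofCycles [Fintype V] [DecidableEq V] {u w : V} {p : G.Walk u u}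
    {q : G.Walk w w} (hp : p.IsCycle) (hq : q.IsCycle)
    (hE : ∀ e ∈ G.edgeSet, e ∈ p.edges ∨ e ∈ q.edges)
    (hpq : ∀ y ∈ p.support, y ∈ q.support → y = u ∧ y = w) : SeriesDecomposition G Bool where
  src b := cond b u w
  tgt b := cond b u w
  walk b := match b with
    | true => p
    | false => q
  isTrail b := by cases b <;> simp [hp.isTrail, hq.isTrail]
  not_nil b := by cases b <;> simp [hp.not_nil, hq.not_nil]
  disjoint := by
    have key : ∀ e ∈ p.edges, e ∉ q.edges := by
      intro e he he'
      induction e with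
      | _ a b =>
        have h1 := (hpq a (p.fst_mem_support_of_mem_edges he) (q.fst_mem_support_of_mem_edges he')).1
        have h2 := (hpq b (p.snd_mem_support_of_mem_edges he) (q.snd_mem_support_of_mem_edges he')).1
        exact (p.adj_of_mem_edges he).ne (h1.trans h2.symm)
    rintro (_ | _) (_ | _) hne e he he'
    · exact hne rfl
    · exact key e he' he
    · exact key e he he'
    · exact hne rfl
  cover e he := (hE e he).elim (fun h => ⟨true, h⟩) fun h => ⟨false, h⟩
  exists_chain_eq := by
    rintro (_ | _) x hb hx
    · refine hq.exists_chain_eq (fun w _ _ => by rw [hb]; rfl) fun y hy hyw e hye he => ?_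
      refine (hE e (hx e he)).resolve_left fun h => hyw ?_
      exact (hpq y (p.mem_support_of_mem_edges h hye) hy).2
    · refine hp.exists_chain_eq (fun w _ _ => by rw [hb]; rfl) fun y hy hyw e hye he => ?_
      refine (hE e (hx e he)).resolve_right fun h => hyw ?_
      exact (hpq y hy (q.mem_support_of_mem_edges h hye)).1

lemma isKLCritical_of_cycles [Finite V] {u w : V} {p : G.Walk u u}
    {q : G.Walk w w} (hp : p.IsCycle) (hq : q.IsCycle) (hpo : Odd p.length) (hqo : Odd q.length)
    (hE : ∀ e ∈ G.edgeSet, e ∈ p.edges ∨ e ∈ q.edges)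
    (hpq : ∀ y ∈ p.support, y ∈ q.support → y = u ∧ y = w) :
    IsKLCritical 3 2 G ∧ (oddCycles G).encard ≤ 4 := by
  classical
  have := Fintype.ofFinite V
  let D := SeriesDecomposition.ofCycles hp hq hE hpq
  -- The base points form an independent set meeting both cycles: an edge between them would put
  -- both on one cycle, which forces them to coincide.
  have huw : ∀ x y, G.Adj x y → (x = u ∨ x = w) → (y = u ∨ y = w) → False := by
    have : ¬ G.Adj u w := fun h => by
      rcases hE s(u, w) h with h' | h'
      · exact h.ne (hpq w (p.snd_mem_support_of_mem_edges h') q.start_mem_support).1.symm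
      · exact h.ne (hpq u p.start_mem_support (q.fst_mem_support_of_mem_edges h')).2
    rintro x y h (rfl | rfl) (rfl | rfl)
    · exact h.ne rfl
    · exact this h
    · exact this h.symm
    · exact h.ne rfl
  refine D.isKLCritical_of_admissible_iff (m := 2)
    (fun k b => if (k = 0) = (b = true) then 1 else 0) (by norm_num) (by norm_num)
    (fun a => ?_) (by decide) (by decide) (I := {u, w})
    (fun x hx y hy h => huw x y h hx hy) (fun k => ?_)
  -- Closed walks have no boundary and both lengths are odd, so only the parity condition remains.
  · have h1 : D.Admissible a ↔ a true + a false = 1 := by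
      constructor
      · rintro ⟨-, h⟩
        have hp' := (ZMod.natCast_eq_one_iff_odd).2 hpo
        have hq' := (ZMod.natCast_eq_one_iff_odd).2 hqo
        simpa [D, SeriesDecomposition.ofCycles, hp', hq'] using h
      · intro h
        have hp' := (ZMod.natCast_eq_one_iff_odd).2 hpo
        have hq' := (ZMod.natCast_eq_one_iff_odd).2 hqo
        refine ⟨fun v => ?_, by simpa [D, SeriesDecomposition.ofCycles, hp', hq'] using h⟩
        simp [D, SeriesDecomposition.ofCycles, CharTwo.add_self_eq_zero]
    rw [h1]
    clear h1
    revert a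
    decide
  · fin_cases k
    · exact ⟨true, by simp, u, by simp, p.start_mem_support⟩
    · exact ⟨false, by simp, w, by simp, q.start_mem_support⟩

lemma mem_edges_of_sup_eq_top {u v w x : V} {p : G.Walk u v} {q : G.Walk w x}
    (h : p.toSubgraph ⊔ q.toSubgraph = ⊤) : ∀ e ∈ G.edgeSet, e ∈ p.edges ∨ e ∈ q.edges := by
  intro e he
  have : e ∈ (⊤ : G.Subgraph).edgeSet := by simpa using he
  rw [← h, Subgraph.edgeSet_sup] at this
  simpa using this

lemma FamilyA.isKLCritical [Finite V] (h : FamilyA G) :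
    IsKLCritical 3 2 G ∧ (oddCycles G).encard ≤ 4 := by
  obtain ⟨_, _, ⟨u, p, hp, hpo, rfl⟩, ⟨w, q, hq, hqo, rfl⟩, htop, hdisj⟩ := h
  refine isKLCritical_of_cycles hp hq hpo hqo (mem_edges_of_sup_eq_top htop) fun y hy hy' => ?_
  have : y ∈ p.toSubgraph.verts ∩ q.toSubgraph.verts := by simpa using ⟨hy, hy'⟩
  rw [hdisj] at this
  exact absurd this (Set.notMem_empty y)

lemma FamilyB.isKLCritical [Finite V] (h : FamilyB G) :
    IsKLCritical 3 2 G ∧ (oddCycles G).encard ≤ 4 := by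
  classical
  obtain ⟨_, _, ⟨u, p, hp, hpo, rfl⟩, ⟨w, q, hq, hqo, rfl⟩, htop, v, hv⟩ := h
  have hmem : ∀ y, (y ∈ p.support ∧ y ∈ q.support) ↔ y = v := fun y => by
    have := Set.ext_iff.1 hv y
    simpa using this
  obtain ⟨hvp, hvq⟩ := (hmem v).2 rfl
  refine isKLCritical_of_cycles (hp.rotate hvp) (hq.rotate hvq) (by simpa using hpo)
    (by simpa using hqo) (mem_edges_of_sup_eq_top (by simpa using htop)) fun y hy hy' => ?_
  have := (hmem y).1 ⟨by simpa using hy, by simpa using hy'⟩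
  exact ⟨this, this⟩

lemma exists_adj_of_mem_support {u v y : V} {p : G.Walk u v} (hp : ¬ p.Nil) (hy : y ∈ p.support) :
    ∃ z, G.Adj y z := by
  obtain ⟨e, he, hye⟩ := (Walk.mem_support_iff_exists_mem_edges_of_not_nil hp).1 hy
  obtain ⟨z, rfl⟩ := hye
  exact ⟨z, p.adj_of_mem_edges he⟩

lemma exists_adj_of_oddCycles {C D : G.Subgraph} (hC : C ∈ oddCycles G) (hD : D ∈ oddCycles G)
    (h : C ⊔ D = ⊤) (v : V) : ∃ w, G.Adj v w := by
  obtain ⟨u, p, hp, hpo, rfl⟩ := hC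
  obtain ⟨w, q, hq, hqo, rfl⟩ := hD
  have : v ∈ (⊤ : G.Subgraph).verts := by simp
  rw [← h, Subgraph.verts_sup] at this
  rcases this with h | h
  · exact exists_adj_of_mem_support hp.not_nil (by simpa using h)
  · exact exists_adj_of_mem_support hq.not_nil (by simpa using h)

/-! ### Family C is critical -/

/-- Internally disjoint paths between two vertices, at most one of which has length one, give a
decomposition. -/
def SeriesDecomposition.ofPaths [Fintype V] [DecidableEq V] {ι : Type*} {x y : V}
    (Q : ι → G.Walk x y) (hxy : x ≠ y) (hQ : ∀ i, (Q i).IsPath)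
    (hd : ∀ i j, i ≠ j → ∀ v, v ∈ (Q i).support → v ∈ (Q j).support → v = x ∨ v = y)
    (h1 : ∀ i j, (Q i).length = 1 → (Q j).length = 1 → i = j)
    (hE : ∀ e ∈ G.edgeSet, ∃ i, e ∈ (Q i).edges) : SeriesDecomposition G ι where
  src _ := x
  tgt _ := y
  walk := Q
  isTrail i := (hQ i).isTrail
  not_nil i := Walk.not_nil_of_ne hxy
  disjoint i j hij e he he' := by
    induction e with
    | _ a b =>
      have ha := hd i j hij a ((Q i).fst_mem_support_of_mem_edges he)
        ((Q j).fst_mem_support_of_mem_edges he')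
      have hb := hd i j hij b ((Q i).snd_mem_support_of_mem_edges he)
        ((Q j).snd_mem_support_of_mem_edges he')
      have hab := ((Q i).adj_of_mem_edges he).ne
      -- A common edge has both ends in `{x, y}`, so both paths would have length 1.
      have hxy' : s(a, b) = s(x, y) := by
        rcases ha with rfl | rfl <;> rcases hb with rfl | rfl
        · exact absurd rfl hab
        · rfl
        · exact Sym2.eq_swap
        · exact absurd rfl hab
      rw [hxy'] at he he'
      exact hij (h1 i j ((hQ i).length_eq_one_of_mem_edges he)
        ((hQ j).length_eq_one_of_mem_edges he'))
  cover := hE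
  exists_chain_eq i z hb hz := by
    refine (hQ i).exists_chain_eq (fun w _ _ _ => by rw [hb]; rfl) fun w hw hwx hwy e hwe he => ?_
    obtain ⟨j, hj⟩ := hE e (hz e he)
    by_contra h
    have hij : i ≠ j := fun h' => h (h' ▸ hj)
    exact (hd i j hij w hw ((Q j).mem_support_of_mem_edges hj hwe)).elim hwx hwy

lemma exists_perm_of_ncard_eq_two {P : Fin 4 → Prop} (h : {i | P i}.ncard = 2) :
    ∃ σ : Equiv.Perm (Fin 4), ∀ i, P (σ i) ↔ i = 0 ∨ i = 1 := by
  obtain ⟨a, b, hab, hP⟩ := Set.ncard_eq_two.1 h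
  have hP' : ∀ i, P i ↔ i = a ∨ i = b := fun i => by
    have := Set.ext_iff.1 hP i
    simpa using this
  have : ∀ a b : Fin 4, a ≠ b → ∃ σ : Equiv.Perm (Fin 4), ∀ i,
      (σ i = a ∨ σ i = b) ↔ i = 0 ∨ i = 1 := by decide
  obtain ⟨σ, hσ⟩ := this a b hab
  exact ⟨σ, fun i => by rw [hP', hσ]⟩

lemma FamilyC.isKLCritical [Finite V] (h : FamilyC G) :
    IsKLCritical 3 2 G ∧ (oddCycles G).encard ≤ 4 := by
  classical
  have := Fintype.ofFinite V
  obtain ⟨x, y, Q, hxy, hQ, hd, hodd, hone, htop⟩ := h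
  obtain ⟨σ, hσ⟩ := exists_perm_of_ncard_eq_two hodd
  have hE : ∀ e ∈ G.edgeSet, ∃ i, e ∈ (Q (σ i)).edges := fun e he => by
    have : e ∈ (⊤ : G.Subgraph).edgeSet := by simpa using he
    rw [← htop, Subgraph.edgeSet_iSup] at this
    simp only [Set.mem_iUnion, Walk.mem_edges_toSubgraph] at this
    obtain ⟨i, hi⟩ := this
    exact ⟨σ.symm i, by simpa using hi⟩
  let D := SeriesDecomposition.ofPaths (fun i => Q (σ i)) hxy (fun i => hQ _)
    (fun i j hij => hd _ _ (σ.injective.ne hij))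
    (fun i j hi hj => σ.injective ((Set.ncard_le_one (Set.toFinite _)).1 hone _ hi _ hj)) hE
  have h0 : ((Q (σ 0)).length : ZMod 2) = 1 := (ZMod.natCast_eq_one_iff_odd).2 ((hσ 0).2 (by simp))
  have h1 : ((Q (σ 1)).length : ZMod 2) = 1 := (ZMod.natCast_eq_one_iff_odd).2 ((hσ 1).2 (by simp))
  have h2 : ((Q (σ 2)).length : ZMod 2) = 0 := (ZMod.natCast_eq_zero_iff_even).2
    (Nat.not_odd_iff_even.1 fun h => by simpa using (hσ 2).1 h)
  have h3 : ((Q (σ 3)).length : ZMod 2) = 0 := (ZMod.natCast_eq_zero_iff_even).2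
    (Nat.not_odd_iff_even.1 fun h => by simpa using (hσ 3).1 h)
  have hI : ∀ v ∈ ({x} : Set V), ∀ w ∈ ({x} : Set V), ¬ G.Adj v w := by
    rintro _ rfl _ rfl h
    exact h.ne rfl
  -- After the reordering by `σ` the paths 0 and 1 are odd. The four vectors select one odd and one
  -- even path, and all the resulting cycles pass through `x`.
  refine D.isKLCritical_of_admissible_iff (m := 4)
    ![![1, 0, 1, 0], ![1, 0, 0, 1], ![0, 1, 1, 0], ![0, 1, 0, 1]] (by norm_num) le_rfl
    (fun a => ?_) (by decide) (by decide) (I := {x}) hI (fun k => ?_)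
  · have hadm : D.Admissible a ↔ a 0 + a 1 + a 2 + a 3 = 0 ∧ a 0 + a 1 = 1 := by
      have hpar : ∑ i, a i * ((D.walk i).length : ZMod 2) = a 0 + a 1 := by
        simp [D, SeriesDecomposition.ofPaths, Fin.sum_univ_four, h0, h1, h2, h3]
      have hbd : ∀ v, ∑ i, a i * ((Pi.single (D.src i) 1 : V → ZMod 2) v +
          (Pi.single (D.tgt i) 1 : V → ZMod 2) v) = (a 0 + a 1 + a 2 + a 3) *
          ((Pi.single x 1 : V → ZMod 2) v + (Pi.single y 1 : V → ZMod 2) v) := fun v => by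
        simp only [D, SeriesDecomposition.ofPaths, Fin.sum_univ_four]
        ring
      constructor
      · rintro ⟨hb, hp⟩
        refine ⟨?_, hpar ▸ hp⟩
        have := hb x
        rw [hbd] at this
        simpa [hxy] using this
      · rintro ⟨hb, hp⟩
        exact ⟨fun v => by rw [hbd, hb, zero_mul], hpar.trans hp⟩
    rw [hadm]
    clear hadm
    revert a
    decide
  · have : ∃ i, (![![1, 0, 1, 0], ![1, 0, 0, 1], ![0, 1, 1, 0], ![0, 1, 0, 1]] :
        Fin 4 → Fin 4 → ZMod 2) k i = 1 := by
      revert k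
      decide
    obtain ⟨i, hi⟩ := this
    exact ⟨i, hi, x, rfl, (Q (σ i)).start_mem_support⟩

lemma FamilyC.exists_adj (h : FamilyC G) (v : V) : ∃ w, G.Adj v w := by
  obtain ⟨x, y, Q, hxy, hQ, hd, hodd, hone, htop⟩ := h
  have : v ∈ (⊤ : G.Subgraph).verts := by simp
  rw [← htop, Subgraph.verts_iSup] at this
  simp only [Set.mem_iUnion, Walk.mem_verts_toSubgraph] at this
  obtain ⟨i, hi⟩ := this
  exact exists_adj_of_mem_support (Walk.not_nil_of_ne hxy) hi

/-! ### Family D is critical -/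

/-- The smaller ends of the six edges of `K₄`. -/
def kFourSrc : Fin 6 → Fin 4 := ![0, 0, 0, 1, 1, 2]

/-- The larger ends of the six edges of `K₄`. -/
def kFourTgt : Fin 6 → Fin 4 := ![1, 2, 3, 2, 3, 3]

/-- The indicator of the edges of the triangle of `K₄` that avoids `k`. -/
def kFourTriangle (k : Fin 4) (r : Fin 6) : ZMod 2 :=
  if kFourSrc r = k ∨ kFourTgt r = k then 0 else 1

lemma kFour_adj (r : Fin 6) : (completeGraph (Fin 4)).Adj (kFourSrc r) (kFourTgt r) := by
  have : ∀ r, kFourSrc r ≠ kFourTgt r := by decide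
  exact this r

lemma exists_kFour_edge {a b : Fin 4} (h : a ≠ b) : ∃ r, s(a, b) = s(kFourSrc r, kFourTgt r) := by
  revert a b
  decide

lemma kFour_edge_injective : Function.Injective fun r => s(kFourSrc r, kFourTgt r) := by
  decide

/-- The cycle space of `K₄` has eight elements: zero, the four triangles, and the three 4-cycles,
each a sum of two triangles. Once all triangles are odd, only they are odd. -/
lemma kFour_cycleSpace (a : Fin 6 → ZMod 2)
    (h : ∀ k, ∑ r, a r * ((if k = kFourSrc r then 1 else 0) + if k = kFourTgt r then 1 else 0) = 0) :
    a = 0 ∨ (∃ k, a = kFourTriangle k) ∨ ∃ k l, a = kFourTriangle k + kFourTriangle l := by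
  revert a
  decide

lemma kFourTriangle_boundary (t k : Fin 4) : ∑ r, kFourTriangle t r *
    ((if k = kFourSrc r then 1 else 0) + if k = kFourTgt r then 1 else 0) = 0 := by
  revert t k
  decide

/-- The parity patterns of the edges of `K₄` in which all triangles are odd. -/
lemma kFour_parity_iff (ℓ : Fin 6 → ZMod 2) :
    (∀ k, ∑ r, kFourTriangle k r * ℓ r = 1) ↔ ((∀ r, ℓ r = 1) ∨
      (∃ i j k : Fin 4, (i ≠ j ∧ j ≠ k ∧ i ≠ k) ∧ ∀ r, ℓ r = 1 ↔
        (s(kFourSrc r, kFourTgt r) = s(i, j) ∨ s(kFourSrc r, kFourTgt r) = s(j, k) ∨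
          s(kFourSrc r, kFourTgt r) = s(i, k))) ∨
      (∃ i j k l : Fin 4, [i, j, k, l].Nodup ∧ ∀ r, ℓ r = 1 ↔
        (s(kFourSrc r, kFourTgt r) = s(i, j) ∨ s(kFourSrc r, kFourTgt r) = s(k, l)))) := by
  revert ℓ
  decide

end SimpleGraph

namespace SubdivisionOf

variable {V W : Type*} {G : SimpleGraph V} {H : SimpleGraph W} (S : SubdivisionOf H G)

lemma mem_edges_path_congr {a b i j : W} (h : s(a, b) = s(i, j)) (hab : H.Adj a b)
    (hij : H.Adj i j) (e : Sym2 V) : e ∈ (S.path a b hab).edges ↔ e ∈ (S.path i j hij).edges := by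
  rw [Sym2.eq_iff] at h
  rcases h with ⟨rfl, rfl⟩ | ⟨rfl, rfl⟩
  · rfl
  · rw [S.path_symm _ _ hij]
    simp

lemma length_path_congr {a b i j : W} (h : s(a, b) = s(i, j)) (hab : H.Adj a b)
    (hij : H.Adj i j) : (S.path a b hab).length = (S.path i j hij).length := by
  rw [Sym2.eq_iff] at h
  rcases h with ⟨rfl, rfl⟩ | ⟨rfl, rfl⟩
  · rfl
  · rw [S.path_symm _ _ hij]
    simp

/-- The two ends of a common edge would be two branch vertices lying on both paths, so both paths
would have the same pair of ends. -/
lemma edges_path_disjoint {i j k l : W} (h : H.Adj i j) (h' : H.Adj k l) (hne : s(i, j) ≠ s(k, l))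
    (e : Sym2 V) (he : e ∈ (S.path i j h).edges) : e ∉ (S.path k l h').edges := by
  intro he'
  induction e with
  | _ a b =>
    have ha1 := Walk.fst_mem_support_of_mem_edges _ he
    have ha2 := Walk.fst_mem_support_of_mem_edges _ he'
    have hb1 := Walk.snd_mem_support_of_mem_edges _ he
    have hb2 := Walk.snd_mem_support_of_mem_edges _ he'
    have hab := (Walk.adj_of_mem_edges _ he).ne
    obtain ⟨m, rfl⟩ := S.disjoint i j h k l h' hne a ha1 ha2
    obtain ⟨n, rfl⟩ := S.disjoint i j h k l h' hne b hb1 hb2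
    have hmn : m ≠ n := fun h => hab (by rw [h])
    have h1 := S.branch_mem i j h m ha1
    have h2 := S.branch_mem k l h' m ha2
    have h3 := S.branch_mem i j h n hb1
    have h4 := S.branch_mem k l h' n hb2
    have hij := h.ne
    have hkl := h'.ne
    grind

lemma mem_edges_path_of_interior {i j : W} (h : H.Adj i j) {w : V} (hw : w ∈ (S.path i j h).support)
    (hwi : w ≠ S.branch i) (hwj : w ≠ S.branch j) {e : Sym2 V} (he : e ∈ G.edgeSet) (hwe : w ∈ e) :
    e ∈ (S.path i j h).edges := by
  obtain ⟨k, l, h', hkl⟩ := S.cover_edges e he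
  by_cases hs : s(i, j) = s(k, l)
  · exact (S.mem_edges_path_congr hs h h' e).2 hkl
  · obtain ⟨m, rfl⟩ := S.disjoint i j h k l h' hs w hw ((S.path k l h').mem_support_of_mem_edges hkl hwe)
    rcases S.branch_mem i j h m hw with rfl | rfl
    · exact absurd rfl hwi
    · exact absurd rfl hwj

lemma exists_adj (S : SubdivisionOf H G) (hH : ∀ i, ∃ j, H.Adj i j) (v : V) : ∃ w, G.Adj v w := by
  have key : ∀ i j (h : H.Adj i j), v ∈ (S.path i j h).support → ∃ w, G.Adj v w :=
    fun i j h hv => exists_adj_of_mem_support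
      (Walk.not_nil_of_ne (S.branch_injective.ne h.ne)) hv
  rcases S.cover_verts v with ⟨i, rfl⟩ | ⟨i, j, h, hv⟩
  · obtain ⟨j, h⟩ := hH i
    exact key i j h (Walk.start_mem_support _)
  · exact key i j h hv

end SubdivisionOf

namespace SimpleGraph

variable {V : Type*} {G : SimpleGraph V}

lemma Walk.IsPath.exists_interior {u v : V} {p : G.Walk u v} (hp : p.IsPath) (huv : u ≠ v)
    (h1 : p.length ≠ 1) : ∃ w ∈ p.support, w ≠ u ∧ w ≠ v := by
  cases p with
  | nil => exact absurd rfl huv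
  | @cons _ w _ h q =>
    rw [Walk.cons_isPath_iff] at hp
    refine ⟨w, by simp, h.ne', fun hw => h1 ?_⟩
    subst hw
    have : q = Walk.nil := by simpa using hp.1
    simp [this]

/-- The path of a subdivision of `K₄` that replaces an edge of `K₄`. -/
def _root_.SubdivisionOf.kFourPath (S : SubdivisionOf (completeGraph (Fin 4)) G) (r : Fin 6) :
    G.Walk (S.branch (kFourSrc r)) (S.branch (kFourTgt r)) :=
  S.path _ _ (kFour_adj r)

lemma _root_.SubdivisionOf.length_path_eq (S : SubdivisionOf (completeGraph (Fin 4)) G)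
    {a b : Fin 4} (h : (completeGraph (Fin 4)).Adj a b) {r : Fin 6}
    (hr : s(a, b) = s(kFourSrc r, kFourTgt r)) :
    (S.path a b h).length = (S.kFourPath r).length :=
  S.length_path_congr hr _ _

/-- The three parity patterns are together the condition that all four triangles are odd. The second
and third have an even path, so a path of length other than 1 comes for free there. -/
lemma familyD_iff : FamilyD G ↔ ∃ S : SubdivisionOf (completeGraph (Fin 4)) G,
    (∀ k, ∑ r, kFourTriangle k r * ((S.kFourPath r).length : ZMod 2) = 1) ∧
      ∃ r, (S.kFourPath r).length ≠ 1 := by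
  have hodd : ∀ (S : SubdivisionOf (completeGraph (Fin 4)) G) (Q : Sym2 (Fin 4) → Prop),
      (∀ a b h, Odd (S.path a b h).length ↔ Q s(a, b)) ↔
        ∀ r, ((S.kFourPath r).length : ZMod 2) = 1 ↔ Q s(kFourSrc r, kFourTgt r) := by
    intro S Q
    constructor
    · intro h r
      rw [ZMod.natCast_eq_one_iff_odd]
      exact h _ _ (kFour_adj r)
    · intro h a b hab
      obtain ⟨r, hr⟩ := exists_kFour_edge hab.ne
      rw [S.length_path_eq hab hr, hr, ← h r, ZMod.natCast_eq_one_iff_odd]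
  refine exists_congr fun S => ?_
  have h1 := hodd S (fun _ => True)
  have h2 := fun i j k => hodd S (fun e => e = s(i, j) ∨ e = s(j, k) ∨ e = s(i, k))
  have h3 := fun i j k l => hodd S (fun e => e = s(i, j) ∨ e = s(k, l))
  simp only [iff_true] at h1
  have hlong : (∃ a b h, (S.path a b h).length ≠ 1) ↔ ∃ r, (S.kFourPath r).length ≠ 1 := by
    constructor
    · rintro ⟨a, b, h, hab⟩
      obtain ⟨r, hr⟩ := exists_kFour_edge h.ne
      exact ⟨r, by rwa [← S.length_path_eq h hr]⟩
    · rintro ⟨r, hr⟩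
      exact ⟨_, _, kFour_adj r, hr⟩
  rw [kFour_parity_iff, hlong, h1]
  simp only [h2, h3]
  have heven : (∃ r, ((S.kFourPath r).length : ZMod 2) ≠ 1) → ∃ r, (S.kFourPath r).length ≠ 1 := by
    rintro ⟨r, hr⟩
    exact ⟨r, fun h => hr (by rw [h]; rfl)⟩
  constructor
  · rintro (⟨h, hl⟩ | ⟨i, j, k, hij, hjk, hik, h⟩ | ⟨i, j, k, l, hn, h⟩)
    · exact ⟨.inl h, hl⟩
    · refine ⟨.inr (.inl ⟨i, j, k, ⟨hij, hjk, hik⟩, h⟩), heven ?_⟩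
      have : ∀ i j k : Fin 4, ∃ r, ¬ (s(kFourSrc r, kFourTgt r) = s(i, j) ∨
        s(kFourSrc r, kFourTgt r) = s(j, k) ∨ s(kFourSrc r, kFourTgt r) = s(i, k)) := by decide
      obtain ⟨r, hr⟩ := this i j k
      exact ⟨r, fun h' => hr ((h r).1 h')⟩
    · refine ⟨.inr (.inr ⟨i, j, k, l, hn, h⟩), heven ?_⟩
      have : ∀ i j k l : Fin 4, ∃ r, ¬ (s(kFourSrc r, kFourTgt r) = s(i, j) ∨
        s(kFourSrc r, kFourTgt r) = s(k, l)) := by decide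
      obtain ⟨r, hr⟩ := this i j k l
      exact ⟨r, fun h' => hr ((h r).1 h')⟩
  · rintro ⟨h | ⟨i, j, k, ⟨hij, hjk, hik⟩, h⟩ | ⟨i, j, k, l, hn, h⟩, hl⟩
    · exact .inl ⟨h, hl⟩
    · exact .inr (.inl ⟨i, j, k, hij, hjk, hik, h⟩)
    · exact .inr (.inr ⟨i, j, k, l, hn, h⟩)

/-- The paths of a subdivision of `K₄` give a decomposition. -/
def SeriesDecomposition.ofSubdivision [Fintype V] [DecidableEq V]
    (S : SubdivisionOf (completeGraph (Fin 4)) G) : SeriesDecomposition G (Fin 6) where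
  src r := S.branch (kFourSrc r)
  tgt r := S.branch (kFourTgt r)
  walk := S.kFourPath
  isTrail r := (S.isPath _ _ _).isTrail
  not_nil r := Walk.not_nil_of_ne (S.branch_injective.ne (kFour_adj r).ne)
  disjoint i j hij := S.edges_path_disjoint _ _ (kFour_edge_injective.ne hij)
  cover e he := by
    obtain ⟨a, b, h, hab⟩ := S.cover_edges e he
    obtain ⟨r, hr⟩ := exists_kFour_edge h.ne
    exact ⟨r, (S.mem_edges_path_congr hr h (kFour_adj r) e).1 hab⟩
  exists_chain_eq r x hb hx :=
    (S.isPath _ _ (kFour_adj r)).exists_chain_eq (fun w _ _ _ => by rw [hb]; rfl)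
      fun _ hw hwi hwj _ hwe he => S.mem_edges_path_of_interior _ hw hwi hwj (hx _ he) hwe

lemma FamilyD.isKLCritical [Finite V] (h : FamilyD G) :
    IsKLCritical 3 2 G ∧ (oddCycles G).encard ≤ 4 := by
  classical
  have := Fintype.ofFinite V
  obtain ⟨S, hpar, r₀, hr₀⟩ := familyD_iff.1 h
  let D := SeriesDecomposition.ofSubdivision S
  obtain ⟨w, hw, hwi, hwj⟩ : ∃ w ∈ (S.kFourPath r₀).support,
      w ≠ S.branch (kFourSrc r₀) ∧ w ≠ S.branch (kFourTgt r₀) := by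
    exact (S.isPath _ _ (kFour_adj r₀)).exists_interior
      (S.branch_injective.ne (kFour_adj r₀).ne) hr₀
  -- The independent set consists of an inner vertex `w` of the long path `r₀` and a branch vertex
  -- `k` off that path: a triangle missing `k` contains both ends of `r₀`, hence `r₀`.
  have hvertex : ∀ r₀, ∃ k, k ≠ kFourSrc r₀ ∧ k ≠ kFourTgt r₀ ∧ ∀ t, kFourTriangle t r₀ = 1 ∨
      ∃ r, kFourTriangle t r = 1 ∧ (kFourSrc r = k ∨ kFourTgt r = k) := by
    decide
  obtain ⟨k, hki, hkj, hk⟩ := hvertex r₀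
  have hadj : ¬ G.Adj w (S.branch k) := fun h => by
    have := S.mem_edges_path_of_interior _ hw hwi hwj (e := s(w, S.branch k)) h (by simp)
    exact (S.branch_mem _ _ _ k (Walk.snd_mem_support_of_mem_edges _ this)).elim hki hkj
  refine D.isKLCritical_of_admissible_iff (m := 4) kFourTriangle (by norm_num) le_rfl
    (fun a => ?_) (by decide) (by decide) (I := {w, S.branch k}) ?_ (fun t => ?_)
  · have hbd : ∀ k, (∑ r, a r * ((Pi.single (D.src r) 1 : V → ZMod 2) (S.branch k) +
        (Pi.single (D.tgt r) 1 : V → ZMod 2) (S.branch k))) =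
        ∑ r, a r * ((if k = kFourSrc r then 1 else 0) + if k = kFourTgt r then 1 else 0) := by
      intro k
      simp [D, SeriesDecomposition.ofSubdivision, Pi.single_apply, S.branch_injective.eq_iff]
    constructor
    · rintro ⟨h1, h2⟩
      rcases kFour_cycleSpace a fun k => (hbd k).symm.trans (h1 _) with rfl | h | ⟨k, l, rfl⟩
      · simp at h2
      · exact h
      -- A sum of two odd triangles has even parity.
      · simp only [Pi.add_apply, add_mul, Finset.sum_add_distrib] at h2
        have : (1 : ZMod 2) + 1 = 1 := (congrArg₂ (· + ·) (hpar k) (hpar l)).symm.trans h2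
        exact absurd this (by decide)
    · rintro ⟨t, rfl⟩
      refine ⟨fun v => ?_, hpar t⟩
      by_cases hv : ∃ k, v = S.branch k
      · obtain ⟨k, rfl⟩ := hv
        rw [hbd, kFourTriangle_boundary]
      · push Not at hv
        simp [D, SeriesDecomposition.ofSubdivision, hv]
  · rintro x (rfl | rfl) y (rfl | rfl) h
    · exact h.ne rfl
    · exact hadj h
    · exact hadj h.symm
    · exact h.ne rfl
  · rcases hk t with h | ⟨r, hr, rfl | rfl⟩
    · exact ⟨r₀, h, w, by simp, hw⟩
    · exact ⟨r, hr, _, .inr rfl, Walk.start_mem_support _⟩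
    · exact ⟨r, hr, _, .inr rfl, Walk.end_mem_support _⟩

/-! ### Converse: two edge-disjoint odd cycles -/

lemma Subgraph.eq_top_of_edgeSet {H : G.Subgraph} (hG : ∀ v, ∃ w, G.Adj v w)
    (h : ∀ e ∈ G.edgeSet, e ∈ H.edgeSet) : H = ⊤ := by
  rw [eq_top_iff]
  refine ⟨fun v _ => ?_, fun v w hvw => h s(v, w) hvw⟩
  obtain ⟨w, hw⟩ := hG v
  exact H.mem_verts_of_mem_edge (h s(v, w) hw) (by simp)

namespace Walk

lemma mem_edges_of_length_eq_one {u v : V} {p : G.Walk u v} (h : p.length = 1) :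
    s(u, v) ∈ p.edges := by
  cases p with
  | nil => simp at h
  | cons h' q =>
    cases q with
    | nil => simp
    | cons => simp at h

lemma edges_nonempty {u v : V} (p : G.Walk u v) (huv : u ≠ v) : ∃ e, e ∈ p.edges := by
  obtain ⟨w, hw⟩ := p.exists_mem_edges_start huv
  exact ⟨_, hw⟩

/-- A cycle that contains no edge outside a second cycle contains all edges of the latter. -/
lemma IsCycle.edges_subset_of_edges_subset [Finite V] {u v : V} {p : G.Walk u u} {q : G.Walk v v}
    (hp : p.IsCycle) (hq : q.IsCycle) (h : ∀ e ∈ q.edges, e ∈ p.edges) :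
    ∀ e ∈ p.edges, e ∈ q.edges := by
  classical
  have := Fintype.ofFinite V
  have hb : chainBoundary q.chain = 0 := by
    rw [chainBoundary_chain]
    ext w
    simp [CharTwo.add_self_eq_zero]
  obtain ⟨c, hc⟩ := hp.exists_chain_eq_of_boundary_eq_zero hb fun e he => by
    by_contra hep
    have : e ∉ q.edges := fun heq => hep (h e heq)
    simp [hq.isTrail.chain_apply, this] at he
  obtain ⟨e₀, he₀⟩ : ∃ e, e ∈ q.edges := by
    by_contra! hn
    exact hq.not_nil (edges_eq_nil.1 (List.eq_nil_iff_forall_not_mem.2 hn))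
  have h1 : c = 1 := by
    rw [← hc e₀ (h e₀ he₀), hq.isTrail.chain_apply, if_pos he₀]
  intro e he
  have := hc e he
  rw [hq.isTrail.chain_apply, h1] at this
  by_contra hn
  simp [hn] at this

/-- A trail between two vertices of an odd cycle shares an edge with an odd cycle in their union. -/
lemma IsCycle.exists_odd_cycle_of_trail [Finite V] {u a b : V} {q : G.Walk u u} (hq : q.IsCycle)
    (hqo : Odd q.length) {α : G.Walk a b} (hα : α.IsTrail) (hab : a ≠ b) (ha : a ∈ q.support)
    (hb : b ∈ q.support) :
    ∃ S ∈ G.oddCycleEdgeSets, (∀ e ∈ S, e ∈ α.edges ∨ e ∈ q.edges) ∧ ∃ e ∈ S, e ∈ α.edges := by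
  classical
  have := Fintype.ofFinite V
  obtain ⟨r, s, hr, hs, hlen, hE, hrs, -⟩ := hq.exists_arcs ha hb hab
  have key : ∀ r s : G.Walk a b, r.IsPath → s.IsPath → (∀ e, e ∈ q.edges ↔ e ∈ r.edges ∨ e ∈ s.edges) →
      (∀ e, e ∈ r.edges → e ∉ s.edges) → Odd (α.length + r.length) →
      ∃ S ∈ G.oddCycleEdgeSets, (∀ e ∈ S, e ∈ α.edges ∨ e ∈ q.edges) ∧ ∃ e ∈ S, e ∈ α.edges := by
    intro r s hr hs hE hrs hodd
    have happ : ∀ e, (α.chain + r.chain) e ≠ 0 → e ∈ α.edges ∨ e ∈ r.edges := by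
      intro e he
      by_contra! hn
      simp [hα.chain_apply, hr.isTrail.chain_apply, hn] at he
    obtain ⟨S, hS, hSx⟩ := exists_odd_cycle_of_chain (G := G) (α.chain + r.chain)
      (fun e he => (happ e he).elim (fun h => α.edges_subset_edgeSet h)
        fun h => r.edges_subset_edgeSet h)
      (by
        rw [map_add, chainBoundary_chain, chainBoundary_chain]
        ext w
        simp only [Pi.add_apply, Pi.zero_apply]
        exact CharTwo.add_self_eq_zero (R := ZMod 2) _)
      (by
        rw [map_add, chainParity_chain, chainParity_chain, ← Nat.cast_add]
        exact (ZMod.natCast_eq_one_iff_odd).2 hodd)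
    refine ⟨S, hS, fun e he => (happ e (hSx e he)).imp_right fun h => (hE e).2 (.inl h), ?_⟩
    -- A cycle inside the arc `r` would contain all edges of `q`, including those of the other arc
    -- `s`.
    by_contra! hn
    have hSr : ∀ e ∈ S, e ∈ r.edges := fun e he => (happ e (hSx e he)).resolve_left (hn e he)
    obtain ⟨v, p, hp, -, rfl⟩ := hS
    obtain ⟨e, he⟩ := s.edges_nonempty hab
    exact hrs e (hSr e (hq.edges_subset_of_edges_subset hp
      (fun e he => (hE e).2 (.inl (hSr e he))) e ((hE e).2 (.inr he)))) he
  -- The two arcs of an odd cycle have different parities, so one of them closes `α` to odd total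
  -- length.
  rcases Nat.even_or_odd (α.length + r.length) with h | h
  · refine key s r hs hr (fun e => (hE e).trans or_comm) (fun e he he' => hrs e he' he) ?_
    grind
  · exact key r s hr hs hE hrs h

lemma IsCycle.exists_three_arcs {w x y z : V} {c : G.Walk w w} (hc : c.IsCycle)
    (hx : x ∈ c.support) (hy : y ∈ c.support) (hz : z ∈ c.support) (hxy : x ≠ y) :
    ∃ (α : G.Walk x y) (β : G.Walk x z) (γ : G.Walk z y), α.IsTrail ∧ β.IsTrail ∧ γ.IsTrail ∧
      (∀ e, e ∈ α.edges → e ∈ c.edges) ∧ (∀ e, e ∈ β.edges → e ∈ c.edges) ∧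
      (∀ e, e ∈ γ.edges → e ∈ c.edges) ∧ (∀ e, e ∈ α.edges → e ∉ β.edges) ∧
      (∀ e, e ∈ α.edges → e ∉ γ.edges) ∧ (∀ e, e ∈ β.edges → e ∉ γ.edges) := by
  classical
  obtain ⟨p, q, hp, hq, -, hE, hpq, hS, -⟩ := hc.exists_arcs hx hy hxy
  have key : ∀ p q : G.Walk x y, p.IsPath → q.IsPath →
      (∀ e, e ∈ c.edges ↔ e ∈ p.edges ∨ e ∈ q.edges) → (∀ e, e ∈ p.edges → e ∉ q.edges) →
      z ∈ q.support → ∃ (α : G.Walk x y) (β : G.Walk x z) (γ : G.Walk z y),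
      α.IsTrail ∧ β.IsTrail ∧ γ.IsTrail ∧
      (∀ e, e ∈ α.edges → e ∈ c.edges) ∧ (∀ e, e ∈ β.edges → e ∈ c.edges) ∧
      (∀ e, e ∈ γ.edges → e ∈ c.edges) ∧ (∀ e, e ∈ α.edges → e ∉ β.edges) ∧
      (∀ e, e ∈ α.edges → e ∉ γ.edges) ∧ (∀ e, e ∈ β.edges → e ∉ γ.edges) := by
    intro p q hp hq hE hpq hz
    have h1 := q.edges_takeUntil_subset_edges hz
    have h2 := q.edges_dropUntil_subset_edges hz
    exact ⟨p, q.takeUntil z hz, q.dropUntil z hz, hp.isTrail, (hq.takeUntil hz).isTrail,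
      (hq.dropUntil hz).isTrail, fun e he => (hE e).2 (.inl he), fun e he => (hE e).2 (.inr (h1 he)),
      fun e he => (hE e).2 (.inr (h2 he)), fun e he he' => hpq e he (h1 he'),
      fun e he he' => hpq e he (h2 he'), fun e he he' =>
        hq.isTrail.disjoint_edges_takeUntil_dropUntil hz he he'⟩
  rcases (hS z).1 hz with h | h
  · exact key q p hq hp (fun e => (hE e).trans or_comm) (fun e he he' => hpq e he' he) h
  · exact key p q hp hq hE hpq h

/-- The common vertices cut `p` into three arcs. Each arc together with `q` contains an odd cycle
that uses an edge of this arc and none of the other two; these three cycles, `p` and `q` are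
distinct. -/
lemma five_le_encard_oddCycleEdgeSets [Finite V] {u w x y z : V} {p : G.Walk u u} {q : G.Walk w w}
    (hp : p.IsCycle) (hq : q.IsCycle) (hpo : Odd p.length) (hqo : Odd q.length)
    (hd : ∀ e ∈ p.edges, e ∉ q.edges) (hx : x ∈ p.support) (hy : y ∈ p.support) (hz : z ∈ p.support)
    (hx' : x ∈ q.support) (hy' : y ∈ q.support) (hz' : z ∈ q.support)
    (hxy : x ≠ y) (hxz : x ≠ z) (hyz : y ≠ z) : 5 ≤ G.oddCycleEdgeSets.encard := by
  obtain ⟨α, β, γ, hα, hβ, hγ, hαp, hβp, hγp, hαβ, hαγ, hβγ⟩ :=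
    hp.exists_three_arcs hx hy hz hxy
  obtain ⟨A, hA, hAsub, a, haA, ha⟩ := hq.exists_odd_cycle_of_trail hqo hα hxy hx' hy'
  obtain ⟨B, hB, hBsub, b, hbB, hb⟩ := hq.exists_odd_cycle_of_trail hqo hβ hxz hx' hz'
  obtain ⟨C, hC, hCsub, c, hcC, hc⟩ := hq.exists_odd_cycle_of_trail hqo hγ hyz.symm hz' hy'
  have haq := hd a (hαp a ha)
  have hbq := hd b (hβp b hb)
  have hcq := hd c (hγp c hc)
  have haB : a ∉ B := fun h => (hBsub a h).elim (hαβ a ha) haq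
  have haC : a ∉ C := fun h => (hCsub a h).elim (hαγ a ha) haq
  have hbC : b ∉ C := fun h => (hCsub b h).elim (hβγ b hb) hbq
  have hbA : b ∉ A := fun h => (hAsub b h).elim (fun h' => hαβ b h' hb) hbq
  have hap : a ∈ p.edgeSet := hαp a ha
  have hbp : b ∈ p.edgeSet := hβp b hb
  have haq' : a ∉ q.edgeSet := haq
  have hbq' : b ∉ q.edgeSet := hbq
  have hcq' : c ∉ q.edgeSet := hcq
  have hsub : ({p.edgeSet, q.edgeSet, A, B, C} : Set (Set (Sym2 V))) ⊆ G.oddCycleEdgeSets := by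
    rintro _ (rfl | rfl | rfl | rfl | rfl)
    exacts [⟨u, p, hp, hpo, rfl⟩, ⟨w, q, hq, hqo, rfl⟩, hA, hB, hC]
  refine le_trans (le_of_eq ?_) (Set.encard_le_encard hsub)
  rw [Set.encard_insert_of_notMem, Set.encard_insert_of_notMem, Set.encard_insert_of_notMem,
    Set.encard_pair]
  · norm_num
  · rintro rfl; exact hbC hbB
  · rintro (rfl | rfl)
    exacts [haB haA, haC haA]
  · rintro (h | h | h)
    exacts [haq' (h ▸ haA), hbq' (h ▸ hbB), hcq' (h ▸ hcC)]
  · rintro (h | h | h | h)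
    exacts [haq' (h ▸ hap), hbA (h ▸ hbp), haB (h ▸ hap), haC (h ▸ hap)]

end Walk

/-- Each odd cycle splits at `x` and `y` into an odd and an even arc. Two arcs of length 1 would
share the edge `s(x, y)`, but the four arcs are edge-disjoint. -/
lemma familyC_of_cycles {u w x y : V} {p : G.Walk u u} {q : G.Walk w w}
    (hG : ∀ v, ∃ w, G.Adj v w) (hp : p.IsCycle) (hq : q.IsCycle) (hpo : Odd p.length)
    (hqo : Odd q.length) (hd : ∀ e ∈ p.edges, e ∉ q.edges)
    (hE : ∀ e ∈ G.edgeSet, e ∈ p.edges ∨ e ∈ q.edges) (hx : x ∈ p.support) (hy : y ∈ p.support)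
    (hx' : x ∈ q.support) (hy' : y ∈ q.support) (hxy : x ≠ y)
    (hmeet : ∀ z, z ∈ p.support → z ∈ q.support → z = x ∨ z = y) : FamilyC G := by
  obtain ⟨p₁, p₂, hp₁, hp₂, hplen, hpE, hpd, hpS, hpI⟩ := hp.exists_arcs hx hy hxy
  obtain ⟨q₁, q₂, hq₁, hq₂, hqlen, hqE, hqd, hqS, hqI⟩ := hq.exists_arcs hx' hy' hxy
  have hmeet' : ∀ z, (z ∈ p₁.support ∨ z ∈ p₂.support) → (z ∈ q₁.support ∨ z ∈ q₂.support) →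
      z = x ∨ z = y := fun z h h' => hmeet z ((hpS z).2 h) ((hqS z).2 h')
  have hd' : ∀ e, (e ∈ p₁.edges ∨ e ∈ p₂.edges) → ¬ (e ∈ q₁.edges ∨ e ∈ q₂.edges) :=
    fun e h h' => hd e ((hpE e).2 h) ((hqE e).2 h')
  refine ⟨x, y, ![p₁, p₂, q₁, q₂], hxy, ?_, ?_, ?_, ?_, ?_⟩
  · intro i
    fin_cases i
    exacts [hp₁, hp₂, hq₁, hq₂]
  · intro i j hij v hi hj
    fin_cases i <;> fin_cases j <;> simp at hij hi hj <;> grind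
  · rw [← hplen] at hpo
    rw [← hqlen] at hqo
    have : ∀ i j : Fin 4, i ≠ j → (∀ k, Odd ((![p₁, p₂, q₁, q₂] : Fin 4 → G.Walk x y) k).length ↔
        k = i ∨ k = j) →
        {k | Odd ((![p₁, p₂, q₁, q₂] : Fin 4 → G.Walk x y) k).length}.ncard = 2 := by
      intro i j hij h
      exact (congrArg Set.ncard (Set.ext h)).trans (Set.ncard_pair hij)
    rcases Nat.even_or_odd p₁.length with h1 | h1 <;> rcases Nat.even_or_odd q₁.length with h2 | h2
    · refine this 1 3 (by decide) fun k => ?_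
      fin_cases k <;> simp <;> grind
    · refine this 1 2 (by decide) fun k => ?_
      fin_cases k <;> simp <;> grind
    · refine this 0 3 (by decide) fun k => ?_
      fin_cases k <;> simp <;> grind
    · refine this 0 2 (by decide) fun k => ?_
      fin_cases k <;> simp <;> grind
  · rw [Set.ncard_le_one (Set.toFinite _)]
    intro i hi j hj
    have hi' := Walk.mem_edges_of_length_eq_one hi
    have hj' := Walk.mem_edges_of_length_eq_one hj
    by_contra hij
    fin_cases i <;> fin_cases j <;> simp at hij hi' hj' <;> grind
  · refine Subgraph.eq_top_of_edgeSet hG fun e he => ?_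
    rw [Subgraph.edgeSet_iSup]
    simp only [Set.mem_iUnion, Walk.mem_edges_toSubgraph]
    rcases hE e he with h | h
    · rcases (hpE e).1 h with h | h
      exacts [⟨0, h⟩, ⟨1, h⟩]
    · rcases (hqE e).1 h with h | h
      exacts [⟨2, h⟩, ⟨3, h⟩]

theorem family_of_disjoint_odd_cycles [Finite V] {u w : V} {p : G.Walk u u} {q : G.Walk w w}
    (hG : ∀ v, ∃ w, G.Adj v w) (hp : p.IsCycle) (hq : q.IsCycle) (hpo : Odd p.length)
    (hqo : Odd q.length) (hd : ∀ e ∈ p.edges, e ∉ q.edges)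
    (hE : ∀ e ∈ G.edgeSet, e ∈ p.edges ∨ e ∈ q.edges) (h4 : G.oddCycleEdgeSets.encard ≤ 4) :
    FamilyA G ∨ FamilyB G ∨ FamilyC G := by
  have hC : p.toSubgraph ∈ oddCycles G := ⟨u, p, hp, hpo, rfl⟩
  have hD : q.toSubgraph ∈ oddCycles G := ⟨w, q, hq, hqo, rfl⟩
  have htop : p.toSubgraph ⊔ q.toSubgraph = ⊤ := Subgraph.eq_top_of_edgeSet hG fun e he => by
    rw [Subgraph.edgeSet_sup]
    simpa using hE e he
  by_cases h0 : ∃ x, x ∈ p.support ∧ x ∈ q.support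
  · obtain ⟨x, hx, hx'⟩ := h0
    by_cases h1 : ∃ y, (y ∈ p.support ∧ y ∈ q.support) ∧ x ≠ y
    · obtain ⟨y, ⟨hy, hy'⟩, hxy⟩ := h1
      refine .inr (.inr (familyC_of_cycles hG hp hq hpo hqo hd hE hx hy hx' hy' hxy
        fun z hz hz' => ?_))
      by_contra! hne
      have := (Walk.five_le_encard_oddCycleEdgeSets hp hq hpo hqo hd hx hy hz hx' hy' hz' hxy
        hne.1.symm hne.2.symm).trans h4
      norm_num at this
    · refine .inr (.inl ⟨_, _, hC, hD, htop, x, ?_⟩)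
      ext y
      simp only [Walk.verts_toSubgraph, Set.mem_inter_iff, Set.mem_ofPred_eq,
        Set.mem_singleton_iff]
      refine ⟨fun h => ?_, ?_⟩
      · by_contra hne
        exact h1 ⟨y, h, Ne.symm hne⟩
      · rintro rfl
        exact ⟨hx, hx'⟩
  · refine .inl ⟨_, _, hC, hD, htop, ?_⟩
    ext y
    simpa using fun hy hy' => h0 ⟨y, hy, hy'⟩

/-! ### Converse: odd cycles that pairwise share edges -/

lemma exists_fourth_fin {i j k : Fin 4} (hij : i ≠ j) (hik : i ≠ k) (hjk : j ≠ k) :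
    ∃ l, l ≠ i ∧ l ≠ j ∧ l ≠ k ∧ ∀ m, m = i ∨ m = j ∨ m = k ∨ m = l := by
  revert i j k
  decide

lemma exists_complement_fin {i j : Fin 4} (hij : i ≠ j) :
    ∃ k l, k ≠ l ∧ ∀ m, (m = k ∨ m = l) ↔ (m ≠ i ∧ m ≠ j) := by
  revert i j
  decide

/-- Four sets which pairwise meet, have no common element, and such that every sum of three of them
contains one of the four, cover each element of their union exactly twice. -/
lemma exists_pair_of_sum_contains {α : Type*} {C : Fin 4 → Set α}
    (hpair : ∀ i j, ∃ e, e ∈ C i ∧ e ∈ C j) (hno : ∀ e, ∃ i, e ∉ C i)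
    (hsum : ∀ i j k, i ≠ j → i ≠ k → j ≠ k →
      ∃ l, ∀ e ∈ C l, (e ∈ C i ↔ (e ∈ C j ↔ e ∈ C k)))
    {e : α} {i : Fin 4} (he : e ∈ C i) : ∃ i j, i ≠ j ∧ ∀ k, e ∈ C k ↔ k = i ∨ k = j := by
  -- The condition in `hsum` says that `e` lies in an odd number of the three sets. If `e` lies in
  -- `C i`, `C j`, `C k`, it misses `C l`, so only `C l` can be contained in the sum of `C i`, `C
  -- j`, `C l`; hence an element of `C l` and `C i` lies in `C j` too. This gives `g` in exactly `i,
  -- j, l` and likewise `g'` in exactly `i, k, l`, and then the sum of `C i`, `C j`, `C k` contains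
  -- none of the four.
  have hthree : ∀ i j k, i ≠ j → i ≠ k → j ≠ k → ∀ e, e ∈ C i → e ∈ C j → e ∉ C k := by
    intro i j k hij hik hjk e hi hj hk
    obtain ⟨l, hli, hlj, hlk, hl⟩ := exists_fourth_fin hij hik hjk
    have hel : e ∉ C l := by
      obtain ⟨m, hm⟩ := hno e
      rcases hl m with rfl | rfl | rfl | rfl
      exacts [absurd hi hm, absurd hj hm, absurd hk hm, hm]
    have key : ∀ i j k, i ≠ j → l ≠ i → l ≠ j → e ∈ C i → e ∈ C j → e ∈ C k →
        (∀ m, m = i ∨ m = j ∨ m = k ∨ m = l) → ∃ g, g ∈ C i ∧ g ∈ C j ∧ g ∈ C l := by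
      intro i j k hij hli hlj hi hj hk hl
      obtain ⟨m, hm⟩ := hsum i j l hij hli.symm hlj.symm
      obtain ⟨g, hg, hg'⟩ := hpair l i
      rcases hl m with rfl | rfl | rfl | rfl
      · have := hm e hi; tauto
      · have := hm e hj; tauto
      · have := hm e hk; tauto
      · have := hm g hg; exact ⟨g, hg', by tauto⟩
    obtain ⟨g, hgi, hgj, hgl⟩ := key i j k hij hli hlj hi hj hk hl
    obtain ⟨g', hgi', hgk', hgl'⟩ := key i k j hik hli hlk hi hk hj fun m => by
      have := hl m; tauto
    obtain ⟨m, hm⟩ := hsum i j k hij hik hjk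
    have hgk : g ∉ C k := fun h => by
      obtain ⟨m, hm⟩ := hno g
      rcases hl m with rfl | rfl | rfl | rfl <;> contradiction
    have hgj' : g' ∉ C j := fun h => by
      obtain ⟨m, hm⟩ := hno g'
      rcases hl m with rfl | rfl | rfl | rfl <;> contradiction
    rcases hl m with rfl | rfl | rfl | rfl
    · have := hm g hgi; tauto
    · have := hm g hgj; tauto
    · have := hm g' hgk'; tauto
    · have := hm g hgl; tauto
  -- If `e` lay in `C i` alone, the sum of the other three sets would not contain `C i`. It contains
  -- none of the others either, since each shares with another of the three an element lying in
  -- exactly two of them.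
  obtain ⟨j, hji, hej⟩ : ∃ j, j ≠ i ∧ e ∈ C j := by
    by_contra! hn
    obtain ⟨j, k, l, hji, hki, hli, hjk, hjl, hkl, hall⟩ : ∃ j k l, j ≠ i ∧ k ≠ i ∧ l ≠ i ∧ j ≠ k ∧
        j ≠ l ∧ k ≠ l ∧ ∀ m, m = i ∨ m = j ∨ m = k ∨ m = l := by
      clear hn he
      revert i
      decide
    obtain ⟨m, hm⟩ := hsum j k l hjk hjl hkl
    have h1 := hn j hji
    have h2 := hn k hki
    have h3 := hn l hli
    obtain ⟨g, hg, hg'⟩ := hpair j k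
    obtain ⟨g', hg1, hg1'⟩ := hpair j l
    rcases hall m with rfl | rfl | rfl | rfl
    · have := hm e he; tauto
    · have := hm g hg
      have := hthree _ _ _ hjk hjl hkl g hg hg'; tauto
    · have := hm g hg'
      have := hthree _ _ _ hjk hjl hkl g hg hg'; tauto
    · have := hm g' hg1'
      have := hthree _ _ _ hjl hjk hkl.symm g' hg1 hg1'; tauto
  refine ⟨i, j, hji.symm, fun k => ⟨fun hk => ?_, ?_⟩⟩
  · by_contra! hn
    exact hthree i j k hji.symm hn.1.symm hn.2.symm e he hej hk
  · rintro (rfl | rfl)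
    exacts [he, hej]

/-- The enumeration may repeat elements, so that fewer than four odd cycles need no separate
treatment. -/
lemma exists_range_eq_of_encard_le {α : Type*} {s : Set α} {n : ℕ} (hs : s.Nonempty)
    (hn : s.encard ≤ n) : ∃ f : Fin n → α, Set.range f = s := by
  classical
  have hfin : s.Finite := Set.finite_of_encard_le_coe hn
  have := hfin.fintype
  have hcard : Fintype.card s ≤ Fintype.card (Fin n) := by
    rw [Fintype.card_fin, ← Nat.cast_le (α := ℕ∞), ← ENat.card_eq_coe_fintype_card]
    exact hn
  obtain ⟨g⟩ := Function.Embedding.nonempty_of_card_le hcard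
  have : Nonempty s := hs.to_subtype
  refine ⟨fun i => (Function.invFun g i : s), ?_⟩
  ext a
  constructor
  · rintro ⟨i, rfl⟩
    exact Subtype.property _
  · intro ha
    obtain ⟨i, hi⟩ := Function.invFun_surjective g.injective ⟨a, ha⟩
    exact ⟨i, congrArg Subtype.val hi⟩

/-- Four odd cycles that pairwise share edges, contain every edge exactly twice, and are all the odd
cycles of `G`. -/
structure OddCycleDoubleCover (G : SimpleGraph V) where
  /-- the base points -/
  base : Fin 4 → V
  /-- the cycles -/
  cycle : ∀ i, G.Walk (base i) (base i)
  isCycle : ∀ i, (cycle i).IsCycle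
  odd : ∀ i, Odd (cycle i).length
  meet : ∀ i j, ∃ e, e ∈ (cycle i).edges ∧ e ∈ (cycle j).edges
  exists_pair : ∀ e ∈ G.edgeSet, ∃ i j, i ≠ j ∧ ∀ k, e ∈ (cycle k).edges ↔ k = i ∨ k = j
  exists_eq : ∀ S ∈ G.oddCycleEdgeSets, ∃ i, S = (cycle i).edgeSet

/-- A sum of three odd cycles has zero boundary and odd parity, so it contains an odd cycle, which
is one of the four listed. This feeds `exists_pair_of_sum_contains`. -/
lemma exists_oddCycleDoubleCover [Finite V] (hne : G.oddCycleEdgeSets.Nonempty)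
    (h4 : G.oddCycleEdgeSets.encard ≤ 4) (hno : ∀ f, ∃ S ∈ G.oddCycleEdgeSets, f ∉ S)
    (hmeet : ∀ S ∈ G.oddCycleEdgeSets, ∀ T ∈ G.oddCycleEdgeSets, ∃ e, e ∈ S ∧ e ∈ T)
    (hcov : ∀ e ∈ G.edgeSet, ∃ S ∈ G.oddCycleEdgeSets, e ∈ S) :
    Nonempty (OddCycleDoubleCover G) := by
  classical
  have := Fintype.ofFinite V
  obtain ⟨C, hC⟩ := exists_range_eq_of_encard_le hne h4
  have hmem : ∀ i, C i ∈ G.oddCycleEdgeSets := fun i => hC ▸ ⟨i, rfl⟩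
  have hex : ∀ S ∈ G.oddCycleEdgeSets, ∃ i, S = C i := fun S hS => by
    rw [← hC] at hS
    obtain ⟨i, rfl⟩ := hS
    exact ⟨i, rfl⟩
  choose base cycle isCycle odd hCe using hmem
  have hCmem : ∀ i e, e ∈ C i ↔ e ∈ (cycle i).edges := fun i e => by rw [hCe]; rfl
  have hsum : ∀ i j k, i ≠ j → i ≠ k → j ≠ k →
      ∃ l, ∀ e ∈ C l, (e ∈ C i ↔ (e ∈ C j ↔ e ∈ C k)) := by
    intro i j k _ _ _
    have happ : ∀ e, ((cycle i).chain + (cycle j).chain + (cycle k).chain) e ≠ 0 →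
        (e ∈ C i ↔ (e ∈ C j ↔ e ∈ C k)) := by
      intro e
      simp only [Pi.add_apply, (isCycle _).isTrail.chain_apply, hCmem]
      by_cases h1 : e ∈ (cycle i).edges <;> by_cases h2 : e ∈ (cycle j).edges <;>
        by_cases h3 : e ∈ (cycle k).edges <;> simp [h1, h2, h3] <;> decide
    have hb : ∀ i, chainBoundary (cycle i).chain = 0 := fun i => by
      rw [Walk.chainBoundary_chain]
      ext w
      simp [CharTwo.add_self_eq_zero]
    have hp : ∀ i, chainParity (cycle i).chain = 1 := fun i => by
      rw [Walk.chainParity_chain]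
      exact (ZMod.natCast_eq_one_iff_odd).2 (odd i)
    obtain ⟨S, hS, hSx⟩ := exists_odd_cycle_of_chain (G := G)
      ((cycle i).chain + (cycle j).chain + (cycle k).chain)
      (fun e he => by
        by_contra hG
        have : ∀ i, e ∉ (cycle i).edges := fun i h => hG ((cycle i).edges_subset_edgeSet h)
        simp [(isCycle _).isTrail.chain_apply, this] at he)
      (by simp [hb]) (by simp only [map_add, hp]; decide)
    obtain ⟨l, rfl⟩ := hex S hS
    exact ⟨l, fun e he => happ e (hSx e he)⟩
  have hmemC : ∀ i, C i ∈ G.oddCycleEdgeSets := fun i => hC ▸ ⟨i, rfl⟩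
  refine ⟨⟨base, cycle, isCycle, odd, fun i j => ?_, fun e he => ?_, fun S hS => ?_⟩⟩
  · simpa only [hCmem] using hmeet _ (hmemC i) _ (hmemC j)
  · obtain ⟨S, hS, heS⟩ := hcov e he
    obtain ⟨i, rfl⟩ := hex S hS
    have := exists_pair_of_sum_contains (fun i j => hmeet _ (hmemC i) _ (hmemC j))
      (fun e => by
        obtain ⟨S, hS, heS⟩ := hno e
        obtain ⟨i, rfl⟩ := hex S hS
        exact ⟨i, heS⟩) hsum heS
    simpa only [hCmem] using this
  · obtain ⟨i, rfl⟩ := hex S hS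
    exact ⟨i, hCe i⟩

lemma Walk.IsCycle.eq_of_mem_edges {u v : V} {c : G.Walk u u} (hc : c.IsCycle) {e f g : Sym2 V}
    (he : e ∈ c.edges) (hf : f ∈ c.edges) (hg : g ∈ c.edges) (hve : v ∈ e) (hvf : v ∈ f)
    (hvg : v ∈ g) : e = f ∨ e = g ∨ f = g := by
  have h2 := hc.ncard_neighborSet_toSubgraph_eq_two (c.mem_support_of_mem_edges he hve)
  obtain ⟨a, rfl⟩ := hve
  obtain ⟨b, rfl⟩ := hvf
  obtain ⟨d, rfl⟩ := hvg
  obtain ⟨x, y, -, hxy⟩ := Set.ncard_eq_two.1 h2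
  have key : ∀ a, s(v, a) ∈ c.edges → a = x ∨ a = y := fun a ha => by
    have : a ∈ c.toSubgraph.neighborSet v := Walk.adj_toSubgraph_iff_mem_edges.2 ha
    rw [hxy] at this
    simpa using this
  have h1 := key a he
  have h2 := key b hf
  have h3 := key d hg
  grind

/-! ### Intersections of the four cycles -/

namespace OddCycleDoubleCover

variable (D : OddCycleDoubleCover G)

lemma not_mem_three {i j k : Fin 4} (hij : i ≠ j) (hik : i ≠ k) (hjk : j ≠ k) {e : Sym2 V}
    (hi : e ∈ (D.cycle i).edges) (hj : e ∈ (D.cycle j).edges) : e ∉ (D.cycle k).edges := by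
  intro hk
  obtain ⟨a, b, -, hab⟩ := D.exists_pair e ((D.cycle i).edges_subset_edgeSet hi)
  have h1 := (hab i).1 hi
  have h2 := (hab j).1 hj
  have h3 := (hab k).1 hk
  grind

lemma exists_other {i : Fin 4} {e : Sym2 V} (hi : e ∈ (D.cycle i).edges) :
    ∃ j, j ≠ i ∧ e ∈ (D.cycle j).edges := by
  obtain ⟨a, b, hne, hab⟩ := D.exists_pair e ((D.cycle i).edges_subset_edgeSet hi)
  rcases (hab i).1 hi with rfl | rfl
  · exact ⟨b, hne.symm, (hab b).2 (.inr rfl)⟩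
  · exact ⟨a, hne, (hab a).2 (.inl rfl)⟩

open Classical in
/-- The chain of the common edges of two of the cycles. -/
noncomputable def interChain (i j : Fin 4) : Sym2 V → ZMod 2 :=
  fun e => if e ∈ (D.cycle i).edges ∧ e ∈ (D.cycle j).edges then 1 else 0

/-- Otherwise the common edges would be all or none of cycle `i`. But that cycle shares an edge with
`j`, and its edge shared with a third cycle is not on `j`. -/
lemma chainBoundary_interChain_ne_zero [Fintype V] [DecidableEq V] {i j : Fin 4} (hij : i ≠ j) :
    chainBoundary (D.interChain i j) ≠ 0 := by
  intro hb
  obtain ⟨c, hc⟩ := (D.isCycle i).exists_chain_eq_of_boundary_eq_zero hb fun e he => by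
    by_contra hn
    simp [interChain, hn] at he
  obtain ⟨k, l, hkl, hm⟩ := exists_complement_fin hij
  have hk := (hm k).1 (.inl rfl)
  obtain ⟨e, hei, hej⟩ := D.meet i j
  obtain ⟨f, hfi, hfk⟩ := D.meet i k
  have hfj : f ∉ (D.cycle j).edges := D.not_mem_three hk.1.symm hij hk.2 hfi hfk
  have h1 := hc e hei
  have h2 := hc f hfi
  simp only [interChain, hei, hej, hfj, hfi, and_self, and_false, if_true, if_false] at h1 h2
  rw [← h2] at h1
  exact absurd h1 (by decide)

/-- At a vertex on no third cycle, every edge of cycle `i` is also on cycle `j`, so the chain agrees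
there with that of cycle `i`, which has no boundary. -/
lemma mem_of_chainBoundary_interChain_ne_zero [Fintype V] [DecidableEq V] {i j : Fin 4} {v : V}
    (hv : chainBoundary (D.interChain i j) v ≠ 0) :
    v ∈ (D.cycle i).support ∧ v ∈ (D.cycle j).support ∧
      ∃ m, m ≠ i ∧ m ≠ j ∧ v ∈ (D.cycle m).support := by
  have hmem : v ∈ (D.cycle i).support ∧ v ∈ (D.cycle j).support := by
    by_contra hn
    refine hv (Finset.sum_eq_zero fun e _ => ?_)
    split_ifs with hve
    · refine if_neg fun he => hn ⟨?_, ?_⟩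
      · exact (D.cycle i).mem_support_of_mem_edges he.1 hve
      · exact (D.cycle j).mem_support_of_mem_edges he.2 hve
    · rfl
  refine ⟨hmem.1, hmem.2, ?_⟩
  by_contra! hn
  have hb : chainBoundary (D.cycle i).chain v = 0 := by
    rw [Walk.chainBoundary_chain]
    exact CharTwo.add_self_eq_zero (R := ZMod 2) _
  refine hv (Eq.trans ?_ hb)
  rw [chainBoundary_apply, chainBoundary_apply]
  refine Finset.sum_congr rfl fun e _ => ?_
  split_ifs with hve
  · rw [(D.isCycle i).isTrail.chain_apply, interChain]
    by_cases hei : e ∈ (D.cycle i).edges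
    · obtain ⟨m, hmi, hem⟩ := D.exists_other hei
      have hmj : m = j := by
        by_contra hmj
        exact hn m hmi hmj ((D.cycle m).mem_support_of_mem_edges hem hve)
      subst hmj
      simp [hei, hem]
    · simp [hei]
  · rfl

lemma sum_chainBoundary_interChain [Fintype V] [DecidableEq V] (i j : Fin 4) :
    ∑ v, chainBoundary (D.interChain i j) v = 0 := by
  refine sum_chainBoundary (G := G) _ fun e he => ?_
  by_contra hn
  have : e ∉ (D.cycle i).edges := fun h => hn ((D.cycle i).edges_subset_edgeSet h)
  simp [interChain, this] at he

variable [Finite V]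

/-- Choose an arc of each cycle so that the total length is odd; their union contains one of the
four cycles. If it is cycle `i`, the unused arc of `i` must run inside the chosen arc of `j`, and
symmetrically for `j`. A third cycle `l` is impossible: its common edge with the fourth cycle would
also lie on `i` or `j`. -/
lemma exists_common_path {i j : Fin 4} (hij : i ≠ j) {u v : V} (huv : u ≠ v)
    (hui : u ∈ (D.cycle i).support) (huj : u ∈ (D.cycle j).support)
    (hvi : v ∈ (D.cycle i).support) (hvj : v ∈ (D.cycle j).support) :
    ∃ w : G.Walk u v, w.IsPath ∧ ∀ e ∈ w.edges, e ∈ (D.cycle i).edges ∧ e ∈ (D.cycle j).edges := by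
  classical
  have := Fintype.ofFinite V
  obtain ⟨p, q, hp, hq, hpq, hE, hd, -⟩ := (D.isCycle i).exists_arcs hui hvi huv
  obtain ⟨r, s, hr, hs, hrs, hE', hd', -⟩ := (D.isCycle j).exists_arcs huj hvj huv
  have key : ∀ p q r s : G.Walk u v, p.IsPath → q.IsPath → r.IsPath → s.IsPath →
      (∀ e, e ∈ (D.cycle i).edges ↔ e ∈ p.edges ∨ e ∈ q.edges) →
      (∀ e, e ∈ (D.cycle j).edges ↔ e ∈ r.edges ∨ e ∈ s.edges) →
      (∀ e, e ∈ p.edges → e ∉ q.edges) → (∀ e, e ∈ r.edges → e ∉ s.edges) →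
      Odd (p.length + r.length) → ∃ w : G.Walk u v, w.IsPath ∧
        ∀ e ∈ w.edges, e ∈ (D.cycle i).edges ∧ e ∈ (D.cycle j).edges := by
    intro p q r s hp hq hr hs hE hE' hd hd' hodd
    have happ : ∀ e, (p.chain + r.chain) e ≠ 0 → e ∈ p.edges ∨ e ∈ r.edges := by
      intro e he
      by_contra! hn
      simp [hp.isTrail.chain_apply, hr.isTrail.chain_apply, hn] at he
    obtain ⟨S, hS, hSx⟩ := exists_odd_cycle_of_chain (G := G) (p.chain + r.chain)
      (fun e he => (happ e he).elim (fun h => p.edges_subset_edgeSet h)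
        fun h => r.edges_subset_edgeSet h)
      (by
        rw [map_add, Walk.chainBoundary_chain, Walk.chainBoundary_chain]
        ext w
        simp only [Pi.add_apply, Pi.zero_apply]
        exact CharTwo.add_self_eq_zero (R := ZMod 2) _)
      (by
        rw [map_add, Walk.chainParity_chain, Walk.chainParity_chain, ← Nat.cast_add]
        exact (ZMod.natCast_eq_one_iff_odd).2 hodd)
    obtain ⟨l, rfl⟩ := D.exists_eq S hS
    have hsub : ∀ e ∈ (D.cycle l).edges, e ∈ p.edges ∨ e ∈ r.edges := fun e he => happ e (hSx e he)
    by_cases hli : l = i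
    · subst hli
      refine ⟨q, hq, fun e he => ?_⟩
      have hel := (hE e).2 (.inr he)
      exact ⟨hel, (hE' e).2 (.inl ((hsub e hel).resolve_left fun h => hd e h he))⟩
    by_cases hlj : l = j
    · subst hlj
      refine ⟨s, hs, fun e he => ?_⟩
      have hel := (hE' e).2 (.inr he)
      exact ⟨(hE e).2 (.inl ((hsub e hel).resolve_right fun h => hd' e h he)), hel⟩
    obtain ⟨m, hmi, hmj, hml, -⟩ := exists_fourth_fin hij (Ne.symm hli) (Ne.symm hlj)
    obtain ⟨e, hel, hem⟩ := D.meet l m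
    rcases hsub e hel with h | h
    · exact absurd ((hE e).2 (.inl h)) (D.not_mem_three hml.symm hli hmi hel hem)
    · exact absurd ((hE' e).2 (.inl h)) (D.not_mem_three hml.symm hlj hmj hel hem)
  rcases Nat.even_or_odd (p.length + r.length) with h | h
  · have h1 := D.odd j
    rw [← hrs] at h1
    exact key p q s r hp hq hs hr hE (fun e => (hE' e).trans or_comm) hd
      (fun e he he' => hd' e he' he) (by grind)
  · exact key p q r s hp hq hr hs hE hE' hd hd' h

lemma exists_common_edge {i j : Fin 4} (hij : i ≠ j) {v : V}
    (hvi : v ∈ (D.cycle i).support) (hvj : v ∈ (D.cycle j).support) :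
    ∃ e, v ∈ e ∧ e ∈ (D.cycle i).edges ∧ e ∈ (D.cycle j).edges := by
  obtain ⟨e, hei, hej⟩ := D.meet i j
  induction e with
  | _ a b =>
    by_cases hva : v = a
    · exact ⟨s(a, b), by simp [hva], hei, hej⟩
    · obtain ⟨w, -, hw⟩ := D.exists_common_path hij hva hvi hvj
        (Walk.fst_mem_support_of_mem_edges _ hei) (Walk.fst_mem_support_of_mem_edges _ hej)
      obtain ⟨y, hy⟩ := w.exists_mem_edges_start hva
      exact ⟨_, by simp, hw _ hy⟩

/-- Otherwise cycle 0 would have three different edges at `v`, one shared with each other cycle. -/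
lemma not_mem_all (v : V) : ∃ i, v ∉ (D.cycle i).support := by
  by_contra! h
  obtain ⟨e, hve, he, he'⟩ := D.exists_common_edge (i := 0) (j := 1) (by decide) (h 0) (h 1)
  obtain ⟨f, hvf, hf, hf'⟩ := D.exists_common_edge (i := 0) (j := 2) (by decide) (h 0) (h 2)
  obtain ⟨g, hvg, hg, hg'⟩ := D.exists_common_edge (i := 0) (j := 3) (by decide) (h 0) (h 3)
  rcases (D.isCycle 0).eq_of_mem_edges he hf hg hve hvf hvg with rfl | rfl | rfl
  · exact D.not_mem_three (by decide) (by decide) (by decide) he he' hf'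
  · exact D.not_mem_three (by decide) (by decide) (by decide) he he' hg'
  · exact D.not_mem_three (by decide) (by decide) (by decide) hf hf' hg'

/-- Common paths of `i, j` and of `i, k` between distinct `u` and `v` would be edge-disjoint, so
their sum would be all of cycle `i`; but the edge shared with the fourth cycle is on neither. -/
lemma eq_of_mem_three {i j k : Fin 4} (hij : i ≠ j) (hik : i ≠ k) (hjk : j ≠ k) {u v : V}
    (hui : u ∈ (D.cycle i).support) (huj : u ∈ (D.cycle j).support)
    (huk : u ∈ (D.cycle k).support) (hvi : v ∈ (D.cycle i).support)
    (hvj : v ∈ (D.cycle j).support) (hvk : v ∈ (D.cycle k).support) : u = v := by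
  classical
  have := Fintype.ofFinite V
  by_contra huv
  obtain ⟨p, hp, hpE⟩ := D.exists_common_path hij huv hui huj hvi hvj
  obtain ⟨q, hq, hqE⟩ := D.exists_common_path hik huv hui huk hvi hvk
  obtain ⟨l, hli, hlj, hlk, -⟩ := exists_fourth_fin hij hik hjk
  obtain ⟨c, hc⟩ := (D.isCycle i).exists_chain_eq_of_boundary_eq_zero (x := p.chain + q.chain)
    (by
      rw [map_add, Walk.chainBoundary_chain, Walk.chainBoundary_chain]
      ext w
      simp only [Pi.add_apply, Pi.zero_apply]
      exact CharTwo.add_self_eq_zero (R := ZMod 2) _)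
    (fun e he => by
      by_contra hn
      have h1 : e ∉ p.edges := fun h => hn (hpE e h).1
      have h2 : e ∉ q.edges := fun h => hn (hqE e h).1
      simp [hp.isTrail.chain_apply, hq.isTrail.chain_apply, h1, h2] at he)
  obtain ⟨e, he⟩ := p.edges_nonempty huv
  have heq : e ∉ q.edges := fun h =>
    D.not_mem_three hij hik hjk (hpE e he).1 (hpE e he).2 (hqE e h).2
  have h1 := hc e (hpE e he).1
  obtain ⟨f, hfi, hfl⟩ := D.meet i l
  have hfp : f ∉ p.edges := fun h => D.not_mem_three hij hli.symm hlj.symm hfi (hpE f h).2 hfl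
  have hfq : f ∉ q.edges := fun h => D.not_mem_three hik hli.symm hlk.symm hfi (hqE f h).2 hfl
  have h2 := hc f hfi
  simp only [Pi.add_apply, hp.isTrail.chain_apply, hq.isTrail.chain_apply, if_pos he, if_neg heq,
    if_neg hfp, if_neg hfq] at h1 h2
  rw [← h2] at h1
  exact absurd h1 (by decide)

/-- The boundary of the common edges of `i` and `j` is nonzero with sum zero, so it has two
vertices, each on a third cycle. By `eq_of_mem_three` they cannot both be on the fourth cycle, so
one is on `k`. -/
lemma exists_mem_three {i j k : Fin 4} (hij : i ≠ j) (hik : i ≠ k) (hjk : j ≠ k) :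
    ∃ v, v ∈ (D.cycle i).support ∧ v ∈ (D.cycle j).support ∧ v ∈ (D.cycle k).support := by
  classical
  have := Fintype.ofFinite V
  obtain ⟨u, hu⟩ := Function.ne_iff.1 (D.chainBoundary_interChain_ne_zero hij)
  obtain ⟨v, huv, hv⟩ : ∃ v, v ≠ u ∧ chainBoundary (D.interChain i j) v ≠ 0 := by
    by_contra! hn
    refine hu ?_
    rw [← Finset.sum_eq_single (s := Finset.univ) u (fun v _ => hn v) (by simp)]
    exact D.sum_chainBoundary_interChain i j
  obtain ⟨hui, huj, m, hmi, hmj, hum⟩ := D.mem_of_chainBoundary_interChain_ne_zero hu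
  obtain ⟨hvi, hvj, n, hni, hnj, hvn⟩ := D.mem_of_chainBoundary_interChain_ne_zero hv
  obtain ⟨l, -, -, -, hl⟩ := exists_fourth_fin hij hik hjk
  by_cases hmk : m = k
  · subst hmk
    exact ⟨u, hui, huj, hum⟩
  by_cases hnk : n = k
  · subst hnk
    exact ⟨v, hvi, hvj, hvn⟩
  have hmn : m = n := by
    rcases hl m with h | h | h | h
    · exact absurd h hmi
    · exact absurd h hmj
    · exact absurd h hmk
    rcases hl n with h' | h' | h' | h'
    · exact absurd h' hni
    · exact absurd h' hnj
    · exact absurd h' hnk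
    exact h.trans h'.symm
  subst hmn
  exact absurd (D.eq_of_mem_three hij hmi.symm hmj.symm hvi hvj hvn hui huj hum) huv

lemma exists_branch (l : Fin 4) : ∃ v, ∀ m, v ∈ (D.cycle m).support ↔ m ≠ l := by
  obtain ⟨i, j, k, hij, hik, hjk, hm⟩ : ∃ i j k : Fin 4, i ≠ j ∧ i ≠ k ∧ j ≠ k ∧
      ∀ m, m ≠ l ↔ m = i ∨ m = j ∨ m = k := by
    revert l
    decide
  obtain ⟨v, hi, hj, hk⟩ := D.exists_mem_three hij hik hjk
  have hne : ∀ m, m ≠ l → v ∈ (D.cycle m).support := fun m hml => by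
    rcases (hm m).1 hml with rfl | rfl | rfl
    exacts [hi, hj, hk]
  refine ⟨v, fun m => ⟨?_, hne m⟩⟩
  rintro h rfl
  obtain ⟨n, hn⟩ := D.not_mem_all v
  by_cases hnm : n = m
  · exact hn (hnm ▸ h)
  · exact hn (hne n hnm)

/-- The vertex on all of the cycles except the given one. -/
noncomputable def branch (l : Fin 4) : V := (D.exists_branch l).choose

lemma branch_mem_iff (l m : Fin 4) : D.branch l ∈ (D.cycle m).support ↔ m ≠ l :=
  (D.exists_branch l).choose_spec m

lemma eq_branch {v : V} {l : Fin 4} (h : ∀ m, m ≠ l → v ∈ (D.cycle m).support) :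
    v = D.branch l := by
  obtain ⟨i, j, k, hij, hik, hjk, hi, hj, hk⟩ : ∃ i j k : Fin 4, i ≠ j ∧ i ≠ k ∧ j ≠ k ∧
      i ≠ l ∧ j ≠ l ∧ k ≠ l := by
    clear h
    revert l
    decide
  exact D.eq_of_mem_three hij hik hjk (h i hi) (h j hj) (h k hk) ((D.branch_mem_iff l i).2 hi)
    ((D.branch_mem_iff l j).2 hj) ((D.branch_mem_iff l k).2 hk)

lemma branch_injective : Function.Injective D.branch := by
  intro k l h
  by_contra hkl
  have := (D.branch_mem_iff l k).2 hkl
  rw [← h, D.branch_mem_iff] at this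
  exact this rfl

/-- For the other two cycles `i` and `j`, the boundary of their common edges sits exactly at the two
branch vertices, as does that of a common path. The difference is constant on cycle `i` and vanishes
on its edge shared with `k`, so the path uses all common edges. -/
lemma exists_branch_path {k l : Fin 4} (hkl : k ≠ l) :
    ∃ w : G.Walk (D.branch k) (D.branch l), w.IsPath ∧
      ∀ e, e ∈ w.edges ↔ ∀ m, m ≠ k → m ≠ l → e ∈ (D.cycle m).edges := by
  classical
  have := Fintype.ofFinite V
  obtain ⟨i, j, hij, hm⟩ := exists_complement_fin hkl
  obtain ⟨hik, hil⟩ := (hm i).1 (.inl rfl)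
  obtain ⟨hjk, hjl⟩ := (hm j).1 (.inr rfl)
  have hne := D.branch_injective.ne hkl
  obtain ⟨w, hw, hwE⟩ := D.exists_common_path hij hne ((D.branch_mem_iff k i).2 hik)
    ((D.branch_mem_iff k j).2 hjk) ((D.branch_mem_iff l i).2 hil) ((D.branch_mem_iff l j).2 hjl)
  have hiff : ∀ e, (∀ m, m ≠ k → m ≠ l → e ∈ (D.cycle m).edges) ↔
      e ∈ (D.cycle i).edges ∧ e ∈ (D.cycle j).edges := fun e => by
    refine ⟨fun h => ⟨h i hik hil, h j hjk hjl⟩, fun h m hmk hml => ?_⟩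
    rcases (hm m).2 ⟨hmk, hml⟩ with rfl | rfl
    exacts [h.1, h.2]
  refine ⟨w, hw, fun e => ⟨fun he => (hiff e).2 (hwE e he), fun he => ?_⟩⟩
  have hsupp : ∀ v, v ≠ D.branch k → v ≠ D.branch l → chainBoundary (D.interChain i j) v = 0 := by
    intro v hvk hvl
    by_contra hv
    obtain ⟨hvi, hvj, m, hmi, hmj, hvm⟩ := D.mem_of_chainBoundary_interChain_ne_zero hv
    have key : m = k ∨ m = l := by
      by_contra! hn
      exact ((hm m).2 hn).elim hmi hmj
    have hall : ∀ n, (n ≠ k ∨ n ≠ l) → n = i ∨ n = j ∨ n = k ∨ n = l := fun n _ => by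
      by_cases h1 : n = k
      · exact .inr (.inr (.inl h1))
      by_cases h2 : n = l
      · exact .inr (.inr (.inr h2))
      exact ((hm n).2 ⟨h1, h2⟩).imp_right .inl
    rcases key with rfl | rfl
    · refine hvl (D.eq_branch fun n hn => ?_)
      rcases hall n (.inr hn) with rfl | rfl | rfl | rfl
      exacts [hvi, hvj, hvm, absurd rfl hn]
    · refine hvk (D.eq_branch fun n hn => ?_)
      rcases hall n (.inl hn) with rfl | rfl | rfl | rfl
      exacts [hvi, hvj, absurd rfl hn, hvm]
  have hsum := D.sum_chainBoundary_interChain i j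
  rw [Finset.sum_eq_add (D.branch k) (D.branch l) hne (fun v _ hv => hsupp v hv.1 hv.2)
    (by simp) (by simp), CharTwo.add_eq_zero] at hsum
  have hk1 : chainBoundary (D.interChain i j) (D.branch k) = 1 := by
    by_contra h1
    have h0 : chainBoundary (D.interChain i j) (D.branch k) = 0 := by
      have : ∀ a : ZMod 2, a ≠ 1 → a = 0 := by decide
      exact this _ h1
    refine D.chainBoundary_interChain_ne_zero hij (funext fun v => ?_)
    by_cases hvk : v = D.branch k
    · rw [hvk, h0]; rfl
    by_cases hvl : v = D.branch l
    · rw [hvl, ← hsum, h0]; rfl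
    exact hsupp v hvk hvl
  have hbd : chainBoundary (w.chain + D.interChain i j) = 0 := by
    rw [map_add, Walk.chainBoundary_chain]
    ext v
    simp only [Pi.add_apply, Pi.zero_apply]
    by_cases hvk : v = D.branch k
    · rw [hvk, hk1]
      simp [hne, CharTwo.add_self_eq_zero]
    by_cases hvl : v = D.branch l
    · rw [hvl, ← hsum, hk1]
      simp [hne.symm, CharTwo.add_self_eq_zero]
    · rw [hsupp v hvk hvl]
      simp [hvk, hvl]
  obtain ⟨c, hc⟩ := (D.isCycle i).exists_chain_eq_of_boundary_eq_zero hbd fun e he => by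
    by_contra hn
    have : e ∉ w.edges := fun h => hn (hwE e h).1
    simp [hw.isTrail.chain_apply, interChain, this, hn] at he
  obtain ⟨f, hfi, hfk⟩ := D.meet i k
  have hfj : f ∉ (D.cycle j).edges := D.not_mem_three hik hij hjk.symm hfi hfk
  have hfw : f ∉ w.edges := fun h => hfj (hwE f h).2
  have h1 := hc f hfi
  have h2 := hc e ((hiff e).1 he).1
  by_contra hew
  simp [hw.isTrail.chain_apply, interChain, hfw, hfj] at h1
  simp [hw.isTrail.chain_apply, interChain, hew, (hiff e).1 he, ← h1] at h2

end OddCycleDoubleCover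

/-! ### The subdivision of `K₄` -/

namespace OddCycleDoubleCover

variable [Finite V] (D : OddCycleDoubleCover G)

/-- The path between two branch vertices, oriented by the order of `Fin 4`. -/
noncomputable def branchPath (k l : Fin 4) (h : k ≠ l) : G.Walk (D.branch k) (D.branch l) :=
  if k < l then (D.exists_branch_path h).choose else (D.exists_branch_path h.symm).choose.reverse

lemma branchPath_symm (k l : Fin 4) (h : k ≠ l) :
    D.branchPath l k h.symm = (D.branchPath k l h).reverse := by
  rcases lt_or_gt_of_ne h with hkl | hkl
  · simp [branchPath, hkl, hkl.not_gt]
  · simp [branchPath, hkl, hkl.not_gt]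

lemma isPath_branchPath (k l : Fin 4) (h : k ≠ l) : (D.branchPath k l h).IsPath := by
  unfold branchPath
  split_ifs
  · exact (D.exists_branch_path h).choose_spec.1
  · exact (D.exists_branch_path h.symm).choose_spec.1.reverse

lemma mem_edges_branchPath (k l : Fin 4) (h : k ≠ l) (e : Sym2 V) :
    e ∈ (D.branchPath k l h).edges ↔ ∀ m, m ≠ k → m ≠ l → e ∈ (D.cycle m).edges := by
  unfold branchPath
  split_ifs
  · exact (D.exists_branch_path h).choose_spec.2 e
  · rw [Walk.edges_reverse, List.mem_reverse, (D.exists_branch_path h.symm).choose_spec.2 e]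
    exact forall_congr' fun m => forall_comm

lemma mem_support_of_mem_branchPath {k l : Fin 4} {h : k ≠ l} {v : V}
    (hv : v ∈ (D.branchPath k l h).support) {m : Fin 4} (hmk : m ≠ k) (hml : m ≠ l) :
    v ∈ (D.cycle m).support := by
  obtain ⟨e, he, hve⟩ := (Walk.mem_support_iff_exists_mem_edges_of_not_nil
    (Walk.not_nil_of_ne (D.branch_injective.ne h))).1 hv
  exact (D.cycle m).mem_support_of_mem_edges ((D.mem_edges_branchPath k l h e).1 he m hmk hml) hve

lemma exists_mem_branchPath {e : Sym2 V} (he : e ∈ G.edgeSet) :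
    ∃ (k l : Fin 4) (h : k ≠ l), e ∈ (D.branchPath k l h).edges := by
  obtain ⟨i, j, hij, hm⟩ := D.exists_pair e he
  obtain ⟨k, l, hkl, hm'⟩ := exists_complement_fin hij
  refine ⟨k, l, hkl, (D.mem_edges_branchPath k l hkl e).2 fun m hmk hml => (hm m).2 ?_⟩
  by_contra! h
  exact ((hm' m).2 h).elim hmk hml

/-- The presentation of `G` as a subdivision of `K₄`. -/
noncomputable def subdivision (hG : ∀ v, ∃ w, G.Adj v w) :
    SubdivisionOf (completeGraph (Fin 4)) G where
  branch := D.branch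
  branch_injective := D.branch_injective
  path k l h := D.branchPath k l h.ne
  path_symm k l h := D.branchPath_symm k l h.ne
  isPath k l h := D.isPath_branchPath k l h.ne
  branch_mem k l h m hm := by
    by_contra! hn
    exact (D.branch_mem_iff m m).1 (D.mem_support_of_mem_branchPath hm hn.1 hn.2) rfl
  disjoint i j h k l h' hne v hv hv' := by
    -- Two different edges of `K₄` have at most one common end `m`. A common vertex of their paths
    -- lies on every cycle except possibly `m`, hence is the branch vertex of `m`.
    have : ∀ i j k l : Fin 4, i ≠ j → k ≠ l → s(i, j) ≠ s(k, l) →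
        ∃ m, ∀ n, n ≠ m → (n ≠ i ∧ n ≠ j) ∨ (n ≠ k ∧ n ≠ l) := by decide
    obtain ⟨m, hm⟩ := this i j k l h.ne h'.ne hne
    refine ⟨m, D.eq_branch fun n hn => ?_⟩
    rcases hm n hn with h1 | h1
    · exact D.mem_support_of_mem_branchPath hv h1.1 h1.2
    · exact D.mem_support_of_mem_branchPath hv' h1.1 h1.2
  cover_verts v := by
    obtain ⟨w, hw⟩ := hG v
    obtain ⟨k, l, h, he⟩ := D.exists_mem_branchPath (e := s(v, w)) hw
    exact .inr ⟨k, l, h, Walk.fst_mem_support_of_mem_edges _ he⟩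
  cover_edges e he := by
    obtain ⟨k, l, h, he⟩ := D.exists_mem_branchPath he
    exact ⟨k, l, h, he⟩

/-- Cycle `t` is the subdivided triangle avoiding `t`, so all triangles are odd. If all paths had
length 1, the branch vertices would be four pairwise adjacent vertices, against 3-colorability. -/
theorem familyD (D : OddCycleDoubleCover G) (hG : ∀ v, ∃ w, G.Adj v w) (h3 : G.Colorable 3) : FamilyD G := by
  classical
  have := Fintype.ofFinite V
  let S := D.subdivision hG
  refine familyD_iff.2 ⟨S, fun t => ?_, ?_⟩
  · let E := SeriesDecomposition.ofSubdivision S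
    have hchain : (D.cycle t).chain = E.chainOf (kFourTriangle t) := by
      ext e
      rw [(D.isCycle t).isTrail.chain_apply]
      by_cases he : e ∈ G.edgeSet
      · obtain ⟨r, hr⟩ := E.cover e he
        rw [E.chainOf_apply _ hr, kFourTriangle]
        have hr' : ∀ m, m ≠ kFourSrc r → m ≠ kFourTgt r → e ∈ (D.cycle m).edges :=
          (D.mem_edges_branchPath _ _ (kFour_adj r).ne e).1 hr
        by_cases ht : kFourSrc r = t ∨ kFourTgt r = t
        · obtain ⟨i, j, hij, hm⟩ := exists_complement_fin (kFour_adj r).ne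
          have hi := (hm i).1 (.inl rfl)
          have hj := (hm j).1 (.inr rfl)
          have hti : i ≠ t := fun h => by
            subst h
            exact ht.elim (fun h => hi.1 h.symm) fun h => hi.2 h.symm
          have htj : j ≠ t := fun h => by
            subst h
            exact ht.elim (fun h => hj.1 h.symm) fun h => hj.2 h.symm
          rw [if_neg (D.not_mem_three hij hti htj (hr' i hi.1 hi.2) (hr' j hj.1 hj.2)), if_pos ht]
        · rw [if_neg ht, if_pos (hr' t (fun h => ht (.inl h.symm)) fun h => ht (.inr h.symm))]
      · rw [E.chainOf_apply_of_notMem _ he, if_neg fun h => he ((D.cycle t).edges_subset_edgeSet h)]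
    have := E.chainParity_chainOf (kFourTriangle t)
    rw [← hchain, Walk.chainParity_chain, (ZMod.natCast_eq_one_iff_odd).2 (D.odd t)] at this
    exact this.symm
  · by_contra! hn
    have hadj : Pairwise fun i j => G.Adj (D.branch i) (D.branch j) := fun i j hij => by
      obtain ⟨r, hr⟩ := exists_kFour_edge hij
      have := hn r
      rw [← S.length_path_eq hij hr] at this
      exact Walk.adj_of_mem_edges _ (Walk.mem_edges_of_length_eq_one this)
    have := h3.card_le_of_pairwise_adj D.branch hadj
    simp at this

end OddCycleDoubleCover

/-! ### Conclusion -/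

theorem family_of_isKLCritical [Finite V] (hG : ∀ v, ∃ w, G.Adj v w) (hcrit : IsKLCritical 3 2 G)
    (h4 : (oddCycles G).encard ≤ 4) : FamilyA G ∨ FamilyB G ∨ FamilyC G ∨ FamilyD G := by
  obtain ⟨h3, hne, hno, hcov⟩ := isKLCritical_three_two_iff.1 hcrit
  rw [encard_oddCycles] at h4
  by_cases hmeet : ∀ S ∈ G.oddCycleEdgeSets, ∀ T ∈ G.oddCycleEdgeSets, ∃ e, e ∈ S ∧ e ∈ T
  -- For an edge on no odd cycle, criticality would give an edge on all of them.
  · have hedge : ∀ e ∈ G.edgeSet, ∃ S ∈ G.oddCycleEdgeSets, e ∈ S := fun e he => by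
      by_contra! hn
      obtain ⟨f, hf⟩ := hcov e he
      obtain ⟨S, hS, hfS⟩ := hno f
      exact hfS (hf S hS (hn S hS))
    obtain ⟨D⟩ := exists_oddCycleDoubleCover hne h4 hno hmeet hedge
    exact .inr (.inr (.inr (D.familyD hG h3)))
  · push Not at hmeet
    obtain ⟨_, ⟨u, p, hp, hpo, rfl⟩, _, ⟨w, q, hq, hqo, rfl⟩, hd⟩ := hmeet
    -- For an edge outside both cycles, criticality would give an edge common to them.
    have hE : ∀ e ∈ G.edgeSet, e ∈ p.edges ∨ e ∈ q.edges := fun e he => by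
      by_contra! hn
      obtain ⟨f, hf⟩ := hcov e he
      exact hd f (hf _ ⟨u, p, hp, hpo, rfl⟩ hn.1) (hf _ ⟨w, q, hq, hqo, rfl⟩ hn.2)
    rcases family_of_disjoint_odd_cycles hG hp hq hpo hqo hd hE h4 with h | h | h
    exacts [.inl h, .inr (.inl h), .inr (.inr (.inl h))]

end SimpleGraph

theorem theorem1 {V : Type*} [Finite V] (G : SimpleGraph V) :
    (FamilyA G ∨ FamilyB G ∨ FamilyC G ∨ FamilyD G) ↔
      ((∀ v, ∃ w, G.Adj v w) ∧ IsKLCritical 3 2 G ∧ (oddCycles G).encard ≤ 4) := by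
  constructor
  · rintro (h | h | h | h)
    · refine ⟨?_, h.isKLCritical⟩
      obtain ⟨C, D, hC, hD, htop, -⟩ := h
      exact exists_adj_of_oddCycles hC hD htop
    · refine ⟨?_, h.isKLCritical⟩
      obtain ⟨C, D, hC, hD, htop, -⟩ := h
      exact exists_adj_of_oddCycles hC hD htop
    · exact ⟨h.exists_adj, h.isKLCritical⟩
    · refine ⟨?_, h.isKLCritical⟩
      obtain ⟨S, -⟩ := h
      exact S.exists_adj fun i => ⟨i + 1, by revert i; decide⟩
  · rintro ⟨hG, hcrit, h4⟩
    exact family_of_isKLCritical hG hcrit h4
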